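/- Let $E,A\in\mathbb{C}^{n\times n}$ and let $\mathcal{A}(s)=sE-A$ be a regular matrix pencil, i.e. $\det(sE-A)$ is not the zero polynomial. Put $\overline{\mathbb{C}}=\mathbb{C}\cup\{\infty\}$, $\mathcal{A}(\infty):=E$, and let the spectrum $\sigma(\mathcal{A})\subseteq\overline{\mathbb{C}}$ consist of all $\lambda\in\mathbb{C}$ for which $0$ is an eigenvalue of $\lambda E-A$, together with $\infty$ if $E$ is singular. A Jordan chain of length $m\ge 1$ at $\lambda\in\mathbb{C}$ is a tuple $(g_0,\dots,g_{m-1})$ in $\mathbb{C}^n$ with $g_0\neq 0$, $(A-\lambda E)g_0=0$ and $(A-\lambda E)g_j=Eg_{j-1}$ for $1\le j\le m-1$; at $\infty$ the conditions are $g_0\ne 0$, $Eg_0=0$ and $Eg_j=Ag_{j-1}$. For $\lambda\in\overline{\mathbb{C}}$ let $\mathcal{L}_\lambda(\mathcal{A})$ be the subspace of $\mathbb{C}^n$ spanned by all elements of all Jordan chains at $\lambda$, let $m_1(\lambda)$ be the length of the longest Jordan chain of $\mathcal{A}$ at $\lambda$, and let $M(\mathcal{A})=\sum_{\lambda\in\sigma(\mathcal{A})}m_1(\lambda)$.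 The rank of a pencil is the largest size of a minor that is not the zero polynomial. Let $\mu_1,\dots,\mu_l\in\overline{\mathbb{C}}$ be pairwise distinct and let $m_1,\dots,m_l\ge 1$ be integers with $\sum_{i=1}^l m_i=M(\mathcal{A})$. (a) There exist $\alpha\in\mathbb{C}\setminus\{0\}$, $\beta\in\mathbb{C}$ and $u,v\in\mathbb{C}^n$ such that for $\mathcal{P}(s)=(\alpha s-\beta)uv^*$ the pencil $\mathcal{A}+\mathcal{P}$ is regular, $$\sigma(\mathcal{A}+\mathcal{P})=\{\mu_1,\dots,\mu_l\}\cup\{\lambda\in\sigma(\mathcal{A}) : \dim\ker\mathcal{A}(\lambda)\ge 2\},\qquad (1)$$ and $$\dim\mathcal{L}_\lambda(\mathcal{A}+\mathcal{P})=\begin{cases}\dim\mathcal{L}_\lambda(\mathcal{A})-m_1(\lambda)+m_i, & \lambda=\mu_i\in\sigma(\mathcal{A}),\\ \dim\mathcal{L}_\lambda(\mathcal{A})-m_1(\lambda), & \lambda\in\sigma(\mathcal{A})\setminus\{\mu_1,\dots,\mu_l\},\\ m_i, & \lambda=\mu_i\notin\sigma(\mathcal{A}),\\ 0, & \lambda\notin\sigma(\mathcal{A})\cup\{\mu_1,\dots,\mu_l\}.\end{cases}\qquad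 (2)$$ Moreover $\mathcal{P}$ has rank one, except possibly if $n=0$, or if $n=1$ and $\infty\in\sigma(\mathcal{A})\cap\{\mu_1,\dots,\mu_l\}$ (then $\mathcal{P}$ may be zero). (b) If $E$ and $A$ are real, $\{\mu_1,\dots,\mu_l\}$ is invariant under complex conjugation (with $\overline{\infty}=\infty$) and $m_i=m_j$ whenever $\mu_j=\overline{\mu_i}$, then there exist $\alpha\in\mathbb{R}\setminus\{0\}$, $\beta\in\mathbb{R}$ and $u,v\in\mathbb{R}^n$ such that for $\mathcal{P}(s)=(\alpha s-\beta)uv^T$ the pencil $\mathcal{A}+\mathcal{P}$ is regular and (1) and (2) hold. Moreover $\mathcal{P}$ has rank one, except possibly in the cases excepted in (a), or if $n=2$ and some non-real $\mu_i$ lies in $\sigma(\mathcal{A})$ (then $\mathcal{P}$ may be zero). -/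

import Mathlib

open Polynomial
open scoped OnePoint

/-- The matrix pencil `s E - A`, given by its two complex `n × n` coefficient matrices. -/
@[ext]
structure MatrixPencil (n : ℕ) where
  E : Matrix (Fin n) (Fin n) ℂ
  A : Matrix (Fin n) (Fin n) ℂ

namespace MatrixPencil

noncomputable section

/-- `(s E - A) + (s F - G) = s (E + F) - (A + G)`. -/
instance (n : ℕ) : Add (MatrixPencil n) where
  add P Q := ⟨P.E + Q.E, P.A + Q.A⟩

/-- The pencil `s E - A` as a matrix with polynomial entries. -/
def poly {n : ℕ} (P : MatrixPencil n) : Matrix (Fin n) (Fin n) ℂ[X] :=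
  (X : ℂ[X]) • P.E.map C - P.A.map C

/-- A pencil is regular if its characteristic polynomial is not the zero polynomial. -/
def IsRegular {n : ℕ} (P : MatrixPencil n) : Prop :=
  P.poly.det ≠ 0

/-- The rank of a pencil: the largest size of a minor that is not the zero polynomial. -/
def rank {n : ℕ} (P : MatrixPencil n) : ℕ :=
  sSup {r | ∃ f g : Fin r → Fin n, (P.poly.submatrix f g).det ≠ 0}

/-- The value of the pencil at a point of `ℂ ∪ {∞}`: the matrix `z E - A` at `z ∈ ℂ`, and the
leading coefficient `E` at `∞`. -/
def eval {n : ℕ} (P : MatrixPencil n) : OnePoint ℂ → Matrix (Fin n) (Fin n) ℂ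
  | ∞ => P.E
  | (z : ℂ) => z • P.E - P.A

/-- The spectrum: those `z ∈ ℂ` for which `0` is an eigenvalue of `z E - A`, together with `∞`
if `E` is singular. -/
def spec {n : ℕ} (P : MatrixPencil n) : Set (OnePoint ℂ) :=
  {lam | match lam with
    | ∞ => ¬ IsUnit P.E
    | (z : ℂ) => Module.End.HasEigenvalue (Matrix.toLin' (z • P.E - P.A)) 0}

/-- The dimension of the kernel of the value of the pencil at a point of `ℂ ∪ {∞}`. -/
def dimKer {n : ℕ} (P : MatrixPencil n) (lam : OnePoint ℂ) : ℕ :=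
  Module.finrank ℂ (LinearMap.ker (Matrix.toLin' (P.eval lam)))

/-- `P.IsJordanChain lam g` says that `g 0, …, g k` is a Jordan chain (of length `k + 1`) of the
pencil at the point `lam` of `ℂ ∪ {∞}`. -/
def IsJordanChain {n : ℕ} (P : MatrixPencil n) (lam : OnePoint ℂ) {k : ℕ}
    (g : Fin (k + 1) → Fin n → ℂ) : Prop :=
  match lam with
  | ∞ =>
      g 0 ≠ 0 ∧ P.E.mulVec (g 0) = 0 ∧
        ∀ j : Fin k, P.E.mulVec (g j.succ) = P.A.mulVec (g j.castSucc)
  | (z : ℂ) =>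
      g 0 ≠ 0 ∧ (P.A - z • P.E).mulVec (g 0) = 0 ∧
        ∀ j : Fin k, (P.A - z • P.E).mulVec (g j.succ) = P.E.mulVec (g j.castSucc)

/-- The root subspace at `lam`: the subspace of all elements of all Jordan chains at `lam`. -/
def rootSubspace {n : ℕ} (P : MatrixPencil n) (lam : OnePoint ℂ) : Submodule ℂ (Fin n → ℂ) :=
  Submodule.span ℂ {x | ∃ (k : ℕ) (g : Fin (k + 1) → Fin n → ℂ),
    P.IsJordanChain lam g ∧ ∃ j, x = g j}

/-- The dimension of the root subspace. -/
def rootDim {n : ℕ} (P : MatrixPencil n) (lam : OnePoint ℂ) : ℕ :=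
  Module.finrank ℂ (P.rootSubspace lam)

/-- The length of the longest Jordan chain at `lam` (which is `0` if there is no chain). -/
def longestChain {n : ℕ} (P : MatrixPencil n) (lam : OnePoint ℂ) : ℕ :=
  sSup {m | ∃ (k : ℕ) (g : Fin (k + 1) → Fin n → ℂ), P.IsJordanChain lam g ∧ m = k + 1}

/-- The sum, over all eigenvalues of the pencil, of the lengths of the longest Jordan chains. -/
def sumLongestChains {n : ℕ} (P : MatrixPencil n) : ℕ :=
  ∑ᶠ lam ∈ P.spec, P.longestChain lam

/-- The pencil `(α s - β) u v^*`. -/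
def rankOnePencil {n : ℕ} (α β : ℂ) (u v : Fin n → ℂ) : MatrixPencil n :=
  ⟨α • Matrix.vecMulVec u (star v), β • Matrix.vecMulVec u (star v)⟩

/-- The pencil has real coefficient matrices. -/
def IsReal {n : ℕ} (P : MatrixPencil n) : Prop :=
  ∃ E₀ A₀ : Matrix (Fin n) (Fin n) ℝ, P.E = E₀.map Complex.ofReal ∧ P.A = A₀.map Complex.ofReal

/-- Complex conjugation on `ℂ ∪ {∞}`, fixing `∞`. -/
def conjPoint (lam : OnePoint ℂ) : OnePoint ℂ :=
  OnePoint.map (starRingEnd ℂ) lam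

/-- `Q` has exactly the points `μ i` and the eigenvalues of `P` of geometric multiplicity at least
two as eigenvalues, and the dimensions of its root subspaces are those of `P` with the longest
chain at every eigenvalue of `P` removed and `m i` added at `μ i`. -/
structure IsPlacement {n l : ℕ} (P Q : MatrixPencil n) (μ : Fin l → OnePoint ℂ) (m : Fin l → ℕ) :
    Prop where
  spec_eq : Q.spec = Set.range μ ∪ {lam | lam ∈ P.spec ∧ 2 ≤ P.dimKer lam}
  dim_of_target_of_spec : ∀ i, μ i ∈ P.spec →
    (Q.rootDim (μ i) : ℤ) = P.rootDim (μ i) - P.longestChain (μ i) + m i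
  dim_of_spec : ∀ lam ∈ P.spec, lam ∉ Set.range μ →
    (Q.rootDim lam : ℤ) = P.rootDim lam - P.longestChain lam
  dim_of_target : ∀ i, μ i ∉ P.spec → Q.rootDim (μ i) = m i
  dim_of_not_mem : ∀ lam, lam ∉ P.spec → lam ∉ Set.range μ → Q.rootDim lam = 0

end

end MatrixPencil

/-!
Choose `γ` (real in the real case) outside the spectrum and different from all targets `μ i`, put
`B = γ E - A` and `N = B⁻¹ E`. The chart `z ↦ (γ - z)⁻¹`, `∞ ↦ 0` turns the Jordan chains of the
pencil into those of the matrix `N`, so that root subspaces have the multiplicities of the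
characteristic polynomial of `N` as dimensions, and longest chains have the multiplicities of its
minimal polynomial `q` as lengths.

The perturbation `(s - γ) (B u) vᵀ` vanishes at `γ`, hence leaves `B` fixed and replaces `N` by
`N + u vᵀ`. With `qᵢ` the quotients of `q` in Horner's scheme,
`charpoly (N + u vᵀ) * q = (q - ∑ Xⁱ vᵀ qᵢ(N) u) * charpoly N`. If the annihilator of `u` is
generated by `q`, the vectors `qᵢ(N) u` are linearly independent and `v` can be chosen such that the
first factor on the right is any prescribed monic polynomial `p` of the degree of `q`. Taking
`p = ∏ (X - chart (μ i)) ^ m i` moves the longest chains to the targets.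

This perturbation is nonzero if `p ≠ q`. If `p = q`, one takes `u` in the kernel of `f(N)` for a
factor `f` of `q` of degree less than `n`, and `v ≠ 0` orthogonal to the cyclic subspace of `u`,
which does not change the characteristic polynomial. Any irreducible `f` will do, except that in
the real case with `n = 2` it has to be linear.
-/

namespace EigenvaluePlacement

open Module Matrix

section RankOneUpdate

variable {R ι : Type*} [CommRing R] [Fintype ι] [DecidableEq ι]

theorem coeff_iterate_divX (f : R[X]) (k j : ℕ) : (divX^[k] f).coeff j = f.coeff (j + k) := by
  induction k generalizing j with
  | zero => simp
  | succ k ih => rw [Function.iterate_succ_apply', coeff_divX, ih, add_right_comm, add_assoc]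

theorem iterate_divX_natDegree {f : R[X]} (hf : f.Monic) : divX^[f.natDegree] f = 1 := by
  ext j
  rw [coeff_iterate_divX, coeff_one]
  split_ifs with h
  · rw [h, zero_add, hf.coeff_natDegree]
  · exact coeff_eq_zero_of_natDegree_lt (by omega)

theorem map_C_aeval_iterate_divX (N : Matrix ι ι R) (f : R[X]) (k : ℕ) :
    (aeval N (divX^[k] f)).map C =
      N.map C * (aeval N (divX^[k + 1] f)).map C + C (f.coeff k) • (1 : Matrix ι ι R[X]) := by
  conv_lhs => rw [← X_mul_divX_add (divX^[k] f), ← Function.iterate_succ_apply' divX]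
  rw [coeff_iterate_divX, zero_add, map_add, map_mul, aeval_X, aeval_C,
    Matrix.map_add _ (by simp), Matrix.map_mul, algebraMap_eq_diagonal, diagonal_map C_0,
    smul_one_eq_diagonal]
  rfl

-- Horner's scheme for the division of `f(X) - f(N)` by `X - N`.
theorem charmatrix_mul_sum_iterate_divX (N : Matrix ι ι R) (f : R[X]) (k : ℕ) :
    N.charmatrix * ∑ i ∈ Finset.range k, (X : R[X]) ^ i • (aeval N (divX^[i + 1] f)).map C =
      (X : R[X]) ^ k • (aeval N (divX^[k] f)).map C - (aeval N f).map C +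
        (∑ i ∈ Finset.range k, X ^ i * C (f.coeff i)) • (1 : Matrix ι ι R[X]) := by
  have hchar : N.charmatrix = (X : R[X]) • (1 : Matrix ι ι R[X]) - N.map C := by
    rw [charmatrix, scalar_apply, smul_one_eq_diagonal]; rfl
  induction k with
  | zero => simp
  | succ k ih =>
    rw [Finset.sum_range_succ, mul_add, ih, Finset.sum_range_succ, add_smul,
      map_C_aeval_iterate_divX N f k, hchar, sub_mul]
    simp only [smul_add, mul_smul, mul_smul_comm, smul_mul_assoc, one_mul, pow_succ]
    abel

theorem charmatrix_mul_sum_iterate_divX_of_aeval_eq_zero {N : Matrix ι ι R} {f : R[X]}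
    (hf : f.Monic) (hN : aeval N f = 0) :
    N.charmatrix * ∑ i ∈ Finset.range f.natDegree,
        (X : R[X]) ^ i • (aeval N (divX^[i + 1] f)).map C = f • (1 : Matrix ι ι R[X]) := by
  have hsum : X ^ f.natDegree + ∑ i ∈ Finset.range f.natDegree, X ^ i * C (f.coeff i) = f := by
    simp_rw [X_pow_mul_C]
    exact hf.as_sum.symm
  rw [charmatrix_mul_sum_iterate_divX, iterate_divX_natDegree hf, hN, map_one,
    Matrix.map_one _ C_0 C_1, Matrix.map_zero _ C_0, sub_zero, ← add_smul, hsum]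

theorem det_smul_one_sub_vecMulVec (f : R) (a b : ι → R) :
    (f • (1 : Matrix ι ι R) - vecMulVec a b).det =
      f ^ Fintype.card ι - a ⬝ᵥ b * f ^ (Fintype.card ι - 1) := by
  rw [smul_one_eq_diagonal, ← scalar_apply, ← eval_charpoly, charpoly_vecMulVec]
  simp

theorem charmatrix_add_vecMulVec (N : Matrix ι ι R) (u v : ι → R) :
    (N + vecMulVec u v).charmatrix = N.charmatrix - vecMulVec (C ∘ u) (C ∘ v) := by
  have hmap : (C : R →+* R[X]).mapMatrix (vecMulVec u v) = vecMulVec (C ∘ u) (C ∘ v) := by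
    ext i j : 2
    simp [vecMulVec_apply]
  rw [charmatrix, charmatrix, map_add, hmap, sub_add_eq_sub_sub]

variable [IsDomain R]

theorem charpoly_add_vecMulVec_mul (N : Matrix ι ι R) (u v : ι → R) {f : R[X]} (hf : f ≠ 0)
    {Q : Matrix ι ι R[X]} (hQ : N.charmatrix * Q = f • (1 : Matrix ι ι R[X])) :
    (N + vecMulVec u v).charpoly * f = (f - (C ∘ v) ⬝ᵥ Q *ᵥ (C ∘ u)) * N.charpoly := by
  cases isEmpty_or_nonempty ι
  · simp [charpoly]
  have hdet : N.charpoly * Q.det = f ^ Fintype.card ι := by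
    rw [charpoly, ← det_mul, hQ, det_smul, det_one, mul_one]
  have hQ0 : Q.det ≠ 0 := right_ne_zero_of_mul (hdet ▸ pow_ne_zero _ hf)
  have hprod : (N + vecMulVec u v).charpoly * Q.det =
      f ^ Fintype.card ι - (C ∘ v) ⬝ᵥ Q *ᵥ (C ∘ u) * f ^ (Fintype.card ι - 1) := by
    rw [charpoly, ← det_mul, charmatrix_add_vecMulVec, sub_mul, hQ, vecMulVec_mul,
      det_smul_one_sub_vecMulVec, dotProduct_comm, dotProduct_mulVec]
  have hpow : f ^ Fintype.card ι = f * f ^ (Fintype.card ι - 1) :=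
    (mul_pow_sub_one Fintype.card_ne_zero f).symm
  apply mul_right_cancel₀ hQ0
  calc (N + vecMulVec u v).charpoly * f * Q.det
      = (N + vecMulVec u v).charpoly * Q.det * f := by ring
    _ = (f - (C ∘ v) ⬝ᵥ Q *ᵥ (C ∘ u)) * f ^ Fintype.card ι := by rw [hprod, hpow]; ring
    _ = (f - (C ∘ v) ⬝ᵥ Q *ᵥ (C ∘ u)) * N.charpoly * Q.det := by rw [← hdet]; ring

theorem charpoly_add_vecMulVec_mul_of_aeval_eq_zero {N : Matrix ι ι R} {f : R[X]} (hf : f.Monic)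
    (hN : aeval N f = 0) (u v : ι → R) :
    (N + vecMulVec u v).charpoly * f =
      (f - ∑ i ∈ Finset.range f.natDegree, X ^ i * C (v ⬝ᵥ aeval N (divX^[i + 1] f) *ᵥ u)) *
        N.charpoly := by
  rw [charpoly_add_vecMulVec_mul N u v hf.ne_zero
    (charmatrix_mul_sum_iterate_divX_of_aeval_eq_zero hf hN), sum_mulVec, dotProduct_sum]
  congr! 3 with i
  rw [smul_mulVec, dotProduct_smul, smul_eq_mul, RingHom.map_dotProduct]
  congr 2
  exact funext fun j => (RingHom.map_mulVec C _ u j).symm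

theorem charpoly_add_vecMulVec_eq_of_forall_dotProduct_eq_zero {N : Matrix ι ι R} {u v : ι → R}
    (h : ∀ f : R[X], v ⬝ᵥ aeval N f *ᵥ u = 0) : (N + vecMulVec u v).charpoly = N.charpoly := by
  have hmul := charpoly_add_vecMulVec_mul_of_aeval_eq_zero N.charpoly_monic
    (aeval_self_charpoly N) u v
  simp only [h, map_zero, mul_zero, Finset.sum_const_zero, sub_zero] at hmul
  exact mul_right_cancel₀ N.charpoly_monic.ne_zero hmul

end RankOneUpdate

section CyclicVector

variable {F ι : Type*} [Field F]

theorem linearIndependent_of_injective_degree {κ : Type*} {w : κ → F[X]} (h0 : ∀ i, w i ≠ 0)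
    (hw : Function.Injective fun i => (w i).degree) : LinearIndependent F w := by
  rw [linearIndependent_iff']
  intro s a ha i hi
  by_contra hai
  have hdeg {j : κ} (hj : a j • w j ≠ 0) : (a j • w j).degree = (w j).degree := by
    rw [smul_eq_C_mul, degree_C_mul (left_ne_zero_of_smul hj)]
  have hsup := degree_sum_eq_of_disjoint (fun j => a j • w j) s fun j hj k hk hjk => by
    simpa only [Function.onFun, Function.comp_apply, hdeg hj.2, hdeg hk.2] using hw.ne hjk
  rw [ha, degree_zero, eq_comm, Finset.sup_eq_bot_iff] at hsup
  exact smul_ne_zero hai (h0 i) (degree_eq_bot.1 (hsup i hi))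

variable [Fintype ι]

theorem exists_dotProduct_eq_of_linearIndependent {κ : Type*} {w : κ → ι → F}
    (hw : LinearIndependent F w) (c : κ → F) : ∃ v : ι → F, ∀ i, v ⬝ᵥ w i = c i := by
  classical
  obtain ⟨φ, hφ⟩ := LinearMap.exists_extend ((Basis.span hw).constr F c)
  obtain ⟨v, rfl⟩ := (dotProductEquiv F ι).surjective φ
  refine ⟨v, fun i => ?_⟩
  have h := congr($hφ (Basis.span hw i))
  rwa [Basis.constr_basis, LinearMap.comp_apply, Submodule.subtype_apply, Basis.span_apply,
    dotProductEquiv_apply_apply] at h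

variable [DecidableEq ι]

theorem minpoly_monic (N : Matrix ι ι F) : (minpoly F N).Monic :=
  minpoly.monic N.isIntegral

/-- The orbit map `f ↦ f(N) u`; its range is the cyclic subspace generated by `u`, its kernel the
annihilator of `u`. -/
noncomputable def cyclicMap (N : Matrix ι ι F) (u : ι → F) : F[X] →ₗ[F] ι → F :=
  (mulVecBilin F F).flip u ∘ₗ (aeval N).toLinearMap

@[simp]
theorem cyclicMap_apply (N : Matrix ι ι F) (u : ι → F) (f : F[X]) :
    cyclicMap N u f = aeval N f *ᵥ u := rfl

theorem exists_minpoly_dvd_of_cyclicMap_eq_zero (N : Matrix ι ι F) :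
    ∃ u : ι → F, ∀ f : F[X], cyclicMap N u f = 0 → minpoly F N ∣ f := by
  have : Module.Finite F[X] (AEval' (toLin' N)) := Module.Finite.of_restrictScalars_finite F _ _
  obtain ⟨x, hx⟩ := exists_ker_toSpanSingleton_eq_annihilator F[X] (AEval' (toLin' N))
  obtain ⟨u, rfl⟩ := (AEval'.of (toLin' N)).surjective x
  refine ⟨u, fun f hf => ?_⟩
  have haeval : aeval (toLin' N) f = toLin' (aeval N f) :=
    aeval_algHom_apply (toLinAlgEquiv' : Matrix ι ι F ≃ₐ[F] _).toAlgHom N f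
  have hmem : f ∈ LinearMap.ker (LinearMap.toSpanSingleton F[X] _ (AEval'.of (toLin' N) u)) := by
    rw [LinearMap.mem_ker, LinearMap.toSpanSingleton_apply, ← AEval.of_aeval_smul, haeval]
    simpa using hf
  rwa [hx, ← span_minpoly_eq_annihilator, Ideal.mem_span_singleton, minpoly_toLin'] at hmem

theorem linearIndependent_cyclicMap_iterate_divX {N : Matrix ι ι F} {u : ι → F} {q : F[X]}
    (hq : q.Monic) (hu : ∀ f : F[X], cyclicMap N u f = 0 → q ∣ f) :
    LinearIndependent F fun i : Fin q.natDegree => cyclicMap N u (divX^[(i : ℕ) + 1] q) := by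
  have hdeg (i : Fin q.natDegree) :
      (divX^[(i : ℕ) + 1] q).degree = (q.natDegree - (i + 1) : ℕ) := by
    refine degree_eq_of_le_of_coeff_ne_zero ((degree_le_iff_coeff_zero _ _).2 fun j hj => ?_) ?_
    · rw [Nat.cast_lt] at hj
      rw [coeff_iterate_divX, coeff_eq_zero_of_natDegree_lt (by omega)]
    · rw [coeff_iterate_divX, Nat.sub_add_cancel i.2, hq.coeff_natDegree]
      exact one_ne_zero
  have hindep : LinearIndependent F fun i : Fin q.natDegree => divX^[(i : ℕ) + 1] q := by
    refine linearIndependent_of_injective_degree (fun i h => ?_) fun i j hij => ?_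
    · simpa [h] using hdeg i
    · simp only [hdeg, Nat.cast_inj] at hij
      omega
  refine hindep.map (Submodule.disjoint_def.2 fun f hf hfu => ?_)
  have hlt : Submodule.span F (Set.range fun i : Fin q.natDegree => divX^[(i : ℕ) + 1] q) ≤
      degreeLT F q.natDegree := by
    rw [Submodule.span_le]
    rintro _ ⟨i, rfl⟩
    rw [SetLike.mem_coe, mem_degreeLT, hdeg, Nat.cast_lt]
    omega
  refine eq_zero_of_dvd_of_degree_lt (hu f hfu) ?_
  rw [degree_eq_natDegree hq.ne_zero]
  exact mem_degreeLT.1 (hlt hf)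

theorem exists_charpoly_add_vecMulVec_mul_minpoly (N : Matrix ι ι F) {p : F[X]} (hp : p.Monic)
    (hdeg : p.natDegree = (minpoly F N).natDegree) :
    ∃ u v : ι → F, (N + vecMulVec u v).charpoly * minpoly F N = p * N.charpoly := by
  set q := minpoly F N
  have hqm : q.Monic := minpoly_monic N
  obtain ⟨u, hu⟩ := exists_minpoly_dvd_of_cyclicMap_eq_zero N
  obtain ⟨v, hv⟩ := exists_dotProduct_eq_of_linearIndependent
    (linearIndependent_cyclicMap_iterate_divX hqm hu) fun i => (q - p).coeff i
  refine ⟨u, v, ?_⟩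
  have hsum : ∑ i ∈ Finset.range q.natDegree, X ^ i * C (v ⬝ᵥ aeval N (divX^[i + 1] q) *ᵥ u) =
      q - p := by
    conv_rhs => rw [hqm.as_sum, hp.as_sum, hdeg, add_sub_add_left_eq_sub, ← Finset.sum_sub_distrib]
    refine Finset.sum_congr rfl fun i hi => ?_
    rw [← cyclicMap_apply, hv ⟨i, Finset.mem_range.1 hi⟩, coeff_sub, map_sub]
    ring
  rw [charpoly_add_vecMulVec_mul_of_aeval_eq_zero hqm (minpoly.aeval F N), hsum, sub_sub_cancel]

theorem exists_mulVec_eq_zero_of_dvd_minpoly {N : Matrix ι ι F} {f : F[X]} (hf : f ∣ minpoly F N)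
    (hunit : ¬ IsUnit f) : ∃ u ≠ 0, aeval N f *ᵥ u = 0 := by
  rw [exists_mulVec_eq_zero_iff]
  by_contra hdet
  obtain ⟨g, hg⟩ := hf
  have hfg : aeval N f * aeval N g = 0 := by rw [← map_mul, ← hg, minpoly.aeval]
  have haeval : aeval N g = 0 :=
    (((isUnit_iff_isUnit_det _).2 (Ne.isUnit hdet)).mul_right_eq_zero).1 hfg
  have hg0 : g ≠ 0 := right_ne_zero_of_mul (hg ▸ (minpoly_monic N).ne_zero)
  have hdvd : f * g ∣ 1 * g := by rw [← hg, one_mul]; exact minpoly.dvd F N haeval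
  exact hunit (isUnit_of_dvd_one ((mul_dvd_mul_iff_right hg0).1 hdvd))

theorem finrank_range_cyclicMap_le {N : Matrix ι ι F} {u : ι → F} {f : F[X]} (hf : f ≠ 0)
    (hu : aeval N f *ᵥ u = 0) : finrank F (LinearMap.range (cyclicMap N u)) ≤ f.natDegree := by
  have hle : LinearMap.range (cyclicMap N u) ≤ (degreeLT F f.natDegree).map (cyclicMap N u) := by
    rintro _ ⟨g, rfl⟩
    refine ⟨g % f, mem_degreeLT.2 ?_, ?_⟩
    · rw [← degree_eq_natDegree hf]
      exact EuclideanDomain.mod_lt g hf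
    · conv_rhs => rw [← EuclideanDomain.mod_add_div g f, mul_comm f]
      rw [map_add, cyclicMap_apply _ _ (_ * f), map_mul, ← mulVec_mulVec, hu, mulVec_zero, add_zero]
  have : FiniteDimensional F (degreeLT F f.natDegree) := (degreeLTEquiv F _).symm.finiteDimensional
  calc finrank F (LinearMap.range (cyclicMap N u))
      ≤ finrank F ((degreeLT F f.natDegree).map (cyclicMap N u)) := Submodule.finrank_mono hle
    _ ≤ finrank F (degreeLT F f.natDegree) := Submodule.finrank_map_le _ _
    _ = f.natDegree := by rw [(degreeLTEquiv F _).finrank_eq, finrank_fin_fun]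

theorem exists_ne_zero_charpoly_add_vecMulVec_eq {N : Matrix ι ι F} {f : F[X]}
    (hf : f ∣ minpoly F N) (hunit : ¬ IsUnit f) (hdeg : f.natDegree < Fintype.card ι) :
    ∃ u v : ι → F, u ≠ 0 ∧ v ≠ 0 ∧ (N + vecMulVec u v).charpoly = N.charpoly := by
  obtain ⟨u, hu0, hu⟩ := exists_mulVec_eq_zero_of_dvd_minpoly hf hunit
  have hproper : LinearMap.range (cyclicMap N u) < ⊤ := by
    refine lt_top_iff_ne_top.2 fun htop => ?_
    have hle := finrank_range_cyclicMap_le (ne_zero_of_dvd_ne_zero (minpoly_monic N).ne_zero hf) hu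
    rw [htop, finrank_top, finrank_fintype_fun_eq_card] at hle
    omega
  obtain ⟨φ, hφ0, hφ⟩ := Submodule.exists_le_ker_of_lt_top _ hproper
  obtain ⟨v, rfl⟩ := (dotProductEquiv F ι).surjective φ
  refine ⟨u, v, hu0, fun hv => hφ0 (by rw [hv, map_zero]), ?_⟩
  exact charpoly_add_vecMulVec_eq_of_forall_dotProduct_eq_zero fun g => hφ ⟨g, rfl⟩

theorem exists_charpoly_add_vecMulVec_mul_minpoly_and_ne_zero (N : Matrix ι ι F) {p : F[X]}
    (hp : p.Monic) (hdeg : p.natDegree = (minpoly F N).natDegree)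
    (hfactor : p = minpoly F N →
      ∃ f, f ∣ minpoly F N ∧ ¬ IsUnit f ∧ f.natDegree < Fintype.card ι) :
    ∃ u v : ι → F, (N + vecMulVec u v).charpoly * minpoly F N = p * N.charpoly ∧
      u ≠ 0 ∧ v ≠ 0 := by
  by_cases hpq : p = minpoly F N
  · obtain ⟨f, hf, hunit, hlt⟩ := hfactor hpq
    obtain ⟨u, v, hu, hv, h⟩ := exists_ne_zero_charpoly_add_vecMulVec_eq hf hunit hlt
    exact ⟨u, v, by rw [h, hpq, mul_comm], hu, hv⟩
  · obtain ⟨u, v, h⟩ := exists_charpoly_add_vecMulVec_mul_minpoly N hp hdeg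
    have hne : vecMulVec u v ≠ 0 := fun h0 => hpq <| by
      rw [h0, add_zero, mul_comm] at h
      exact (mul_right_cancel₀ N.charpoly_monic.ne_zero h).symm
    refine ⟨u, v, h, ?_, ?_⟩ <;> rintro rfl <;> simp at hne

end CyclicVector

section BaseChange

variable {F K ι : Type*} [Field F] [Field K] [Algebra F K] [Fintype ι] [DecidableEq ι]

theorem exists_monic_aeval_eq_zero_of_map {N : Matrix ι ι F} {q : K[X]} (hq : q.Monic)
    (hN : aeval (N.map (algebraMap F K)) q = 0) :
    ∃ g : F[X], g.Monic ∧ g.natDegree ≤ q.natDegree ∧ aeval N g = 0 := by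
  -- Apply an `F`-linear functional `K → F` with `1 ↦ 1` to the coefficients of `q`.
  obtain ⟨φ, hφ⟩ := Projective.exists_dual_eq_one F (one_ne_zero : (1 : K) ≠ 0)
  set g : F[X] := ∑ k ∈ Finset.range (q.natDegree + 1), monomial k (φ (q.coeff k))
  have hdeg : g.natDegree ≤ q.natDegree :=
    natDegree_sum_le_of_forall_le _ _ fun k hk =>
      (natDegree_monomial_le _).trans (Finset.mem_range_succ_iff.1 hk)
  refine ⟨g, monic_of_natDegree_le_of_coeff_eq_one _ hdeg ?_, hdeg, ?_⟩
  · simp [g, finsetSum_coeff, coeff_monomial, hq.coeff_natDegree, hφ]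
  · ext i j
    have hentry := congr($hN i j)
    rw [aeval_eq_sum_range, Matrix.sum_apply, Matrix.zero_apply] at hentry
    rw [map_sum, Matrix.sum_apply, Matrix.zero_apply, ← map_zero φ, ← hentry, map_sum]
    refine Finset.sum_congr rfl fun k _ => ?_
    have hpow : N.map (algebraMap F K) ^ k = (N ^ k).map (algebraMap F K) :=
      (map_pow (algebraMap F K).mapMatrix N k).symm
    rw [aeval_monomial, ← Algebra.smul_def, Matrix.smul_apply, hpow, Matrix.smul_apply, map_apply,
      smul_eq_mul, smul_eq_mul, mul_comm (q.coeff k), ← Algebra.smul_def, map_smul, smul_eq_mul,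
      mul_comm]

theorem minpoly_map_algebraMap (N : Matrix ι ι F) :
    minpoly K (N.map (algebraMap F K)) = (minpoly F N).map (algebraMap F K) := by
  have haeval : aeval (N.map (algebraMap F K)) ((minpoly F N).map (algebraMap F K)) =
      (aeval N (minpoly F N)).map (algebraMap F K) := by
    rw [aeval_map_algebraMap]
    exact aeval_algHom_apply (Algebra.ofId F K).mapMatrix N _
  have hdvd : minpoly K (N.map (algebraMap F K)) ∣ (minpoly F N).map (algebraMap F K) :=
    minpoly.dvd _ _ (by rw [haeval, minpoly.aeval, Matrix.map_zero _ (map_zero _)])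
  obtain ⟨g, hgm, hgdeg, hg⟩ := exists_monic_aeval_eq_zero_of_map
    (minpoly_monic _) (minpoly.aeval K (N.map (algebraMap F K)))
  refine (eq_of_monic_of_dvd_of_natDegree_le (minpoly_monic _) ((minpoly_monic N).map _) hdvd
    ?_).symm
  exact (natDegree_map _).le.trans ((natDegree_le_natDegree (minpoly.min F N hgm hg)).trans hgdeg)

end BaseChange

end EigenvaluePlacement

namespace EigenvaluePlacement

open Module End

section GeneralizedEigenspaces

variable {K V : Type*} [Field K] [AddCommGroup V] [Module K V]

theorem mem_genEigenspace_iff_aeval {f : End K V} {a : K} {k : ℕ} {x : V} :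
    x ∈ f.genEigenspace a k ↔ aeval f ((X - C a) ^ k) x = 0 := by
  rw [mem_genEigenspace_nat, LinearMap.mem_ker, map_pow, map_sub, aeval_X, aeval_C,
    Algebra.algebraMap_eq_smul_one]

variable [FiniteDimensional K V]

theorem minpoly_ne_zero (f : End K V) : minpoly K f ≠ 0 :=
  minpoly.ne_zero (Algebra.IsIntegral.isIntegral f)

theorem maxGenEigenspace_eq_genEigenspace_rootMultiplicity (f : End K V) (a : K) :
    f.maxGenEigenspace a = f.genEigenspace a ((minpoly K f).rootMultiplicity a : ℕ) := by
  refine le_antisymm (fun x hx => ?_) (f.genEigenspace_le_maximal a _)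
  obtain ⟨g, hg, hndvd⟩ :=
    exists_eq_pow_rootMultiplicity_mul_and_not_dvd _ (minpoly_ne_zero f) a
  set k := (minpoly K f).rootMultiplicity a
  rw [maxGenEigenspace_eq, mem_genEigenspace_iff_aeval] at hx
  obtain ⟨b, c, hbc⟩ : IsCoprime ((X - C a) ^ f.maxGenEigenspaceIndex a) g :=
    ((irreducible_X_sub_C a).coprime_iff_not_dvd.2 hndvd).pow_left
  have hk : (X - C a) ^ k =
      b * (X - C a) ^ k * (X - C a) ^ f.maxGenEigenspaceIndex a + c * minpoly K f := by
    rw [hg]; linear_combination (-(X - C a) ^ k) * hbc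
  rw [mem_genEigenspace_iff_aeval, hk, map_add, map_mul, map_mul _ c, minpoly.aeval, mul_zero,
    add_zero, mul_apply, hx, map_zero]

theorem genEigenspace_lt_succ_of_rootMultiplicity_eq {f : End K V} {a : K} {k : ℕ}
    (hk : (minpoly K f).rootMultiplicity a = k + 1) :
    f.genEigenspace a k < f.genEigenspace a (k + 1 : ℕ) := by
  refine lt_of_le_not_ge ((f.genEigenspace a).monotone (by exact_mod_cast k.le_succ)) fun hle => ?_
  obtain ⟨g, hg, -⟩ := exists_eq_pow_rootMultiplicity_mul_and_not_dvd _ (minpoly_ne_zero f) a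
  rw [hk, pow_succ', mul_assoc] at hg
  set p := (X - C a) ^ k * g with hp
  have hp0 : p ≠ 0 := right_ne_zero_of_mul (hg ▸ minpoly_ne_zero f)
  have hfp : aeval f p = 0 := by
    ext y
    rw [hp, map_mul, mul_apply, LinearMap.zero_apply, ← mem_genEigenspace_iff_aeval]
    apply hle
    rw [mem_genEigenspace_iff_aeval, ← mul_apply, ← map_mul, pow_succ', mul_assoc, ← hp, ← hg,
      minpoly.aeval, LinearMap.zero_apply]
  have hdvd : (X - C a) * p ∣ 1 * p := by rw [one_mul, ← hg]; exact minpoly.dvd K f hfp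
  exact not_isUnit_X_sub_C a (isUnit_of_dvd_one ((mul_dvd_mul_iff_right hp0).1 hdvd))

theorem genEigenspace_lt_succ {f : End K V} {a : K} {j : ℕ}
    (hj : j < (minpoly K f).rootMultiplicity a) :
    f.genEigenspace a j < f.genEigenspace a (j + 1 : ℕ) := by
  refine lt_of_le_of_ne ((f.genEigenspace a).monotone (by exact_mod_cast j.le_succ)) fun h => ?_
  obtain ⟨i, hi⟩ := Nat.exists_eq_add_of_lt hj
  have hlt := genEigenspace_lt_succ_of_rootMultiplicity_eq hi
  simp only [genEigenspace_nat] at h hlt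
  rw [add_assoc, ← ker_pow_constant h i, ← ker_pow_constant h (i + 1)] at hlt
  exact lt_irrefl _ hlt

theorem finrank_genEigenspace_le_mul (f : End K V) (a : K) (k : ℕ) :
    finrank K (f.genEigenspace a k) ≤ k * finrank K (f.eigenspace a) := by
  induction k with
  | zero => simp
  | succ k ih =>
    set W := f.genEigenspace a (k + 1 : ℕ)
    set S := (aeval f ((X - C a) ^ k)).domRestrict W
    have hrange : LinearMap.range S ≤ f.eigenspace a := by
      rintro _ ⟨⟨x, hx⟩, rfl⟩
      have hx' := mem_genEigenspace_iff_aeval.1 hx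
      rw [pow_succ', map_mul, mul_apply, map_sub, aeval_X, aeval_C,
        Algebra.algebraMap_eq_smul_one] at hx'
      rw [eigenspace_def]
      exact hx'
    have hker : finrank K (LinearMap.ker S) ≤ finrank K (f.genEigenspace a k) := by
      rw [← Submodule.finrank_map_subtype_eq]
      apply Submodule.finrank_mono
      rintro _ ⟨x, hx, rfl⟩
      exact mem_genEigenspace_iff_aeval.2 hx
    calc finrank K W = finrank K (LinearMap.range S) + finrank K (LinearMap.ker S) :=
          (LinearMap.finrank_range_add_finrank_ker S).symm
      _ ≤ finrank K (f.eigenspace a) + k * finrank K (f.eigenspace a) :=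
          add_le_add (Submodule.finrank_mono hrange) (hker.trans ih)
      _ = (k + 1) * finrank K (f.eigenspace a) := by ring

theorem finrank_eigenspace_add_le {f : End K V} {a : K} {j : ℕ}
    (hj : j < (minpoly K f).rootMultiplicity a) :
    finrank K (f.eigenspace a) + j ≤ finrank K (f.genEigenspace a (j + 1 : ℕ)) := by
  induction j with
  | zero => rfl
  | succ j ih =>
    have hlt := Submodule.finrank_lt_finrank_of_lt (genEigenspace_lt_succ hj)
    have hle := ih (by omega)
    omega

theorem two_le_finrank_eigenspace_iff (f : End K V) (a : K) :
    2 ≤ finrank K (f.eigenspace a) ↔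
      (minpoly K f).rootMultiplicity a < f.charpoly.rootMultiplicity a := by
  rw [← LinearMap.finrank_maxGenEigenspace_eq, maxGenEigenspace_eq_genEigenspace_rootMultiplicity]
  rcases hk : (minpoly K f).rootMultiplicity a with _ | k
  · have hroot : ¬ (minpoly K f).IsRoot a := fun h =>
      ((rootMultiplicity_pos (minpoly_ne_zero f)).2 h).ne' hk
    have hbot : f.eigenspace a = ⊥ := by
      rwa [← hasEigenvalue_iff_isRoot, hasEigenvalue_iff, not_not] at hroot
    have hgeom : finrank K (f.eigenspace a) = 0 := by rw [hbot, finrank_bot]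
    have halg : finrank K (f.genEigenspace a (0 : ℕ)) = 0 := by
      rw [Nat.cast_zero, genEigenspace_zero, finrank_bot]
    omega
  · have hlower := finrank_eigenspace_add_le (f := f) (a := a) (j := k) (by omega)
    have hupper := finrank_genEigenspace_le_mul f a (k + 1)
    refine ⟨fun h => by omega, fun h => ?_⟩
    by_contra! hlt
    have := Nat.mul_le_mul_left (k + 1) (Nat.le_of_lt_succ hlt)
    omega

end GeneralizedEigenspaces

section JordanSequences

variable {K V W U : Type*} [Field K] [AddCommGroup V] [Module K V] [AddCommGroup W] [Module K W]
  [AddCommGroup U] [Module K U]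

/-- `g₀, …, gₖ` is a Jordan chain at `0` of the operator pencil `T - s R`: `g₀ ≠ 0`, `T g₀ = 0`
and `T gⱼ₊₁ = R gⱼ`. The chains of a matrix pencil at every point of `ℂ ∪ {∞}` have this form. -/
def IsJordanSequence (T R : V →ₗ[K] W) {k : ℕ} (g : Fin (k + 1) → V) : Prop :=
  g 0 ≠ 0 ∧ T (g 0) = 0 ∧ ∀ j : Fin k, T (g j.succ) = R (g j.castSucc)

theorem isJordanSequence_comp_iff {S : W →ₗ[K] U} (hS : Function.Injective S) {T R : V →ₗ[K] W}
    {k : ℕ} {g : Fin (k + 1) → V} :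
    IsJordanSequence (S ∘ₗ T) (S ∘ₗ R) g ↔ IsJordanSequence T R g := by
  simp only [IsJordanSequence, LinearMap.comp_apply, hS.eq_iff, map_eq_zero_iff S hS]

variable {T R : End K V} {k : ℕ}

theorem IsJordanSequence.pow_apply (hTR : Commute T R) {g : Fin (k + 1) → V}
    (hg : IsJordanSequence T R g) (j : Fin (k + 1)) :
    (T ^ (j : ℕ)) (g j) = (R ^ (j : ℕ)) (g 0) := by
  induction j using Fin.induction with
  | zero => rfl
  | succ j ih =>
    rw [Fin.val_succ, pow_succ, mul_apply, hg.2.2 j, ← mul_apply, (hTR.pow_left _).eq, mul_apply,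
      ← Fin.val_castSucc, ih, ← mul_apply, ← pow_succ']

theorem IsJordanSequence.mem_ker_pow_succ (hTR : Commute T R) {g : Fin (k + 1) → V}
    (hg : IsJordanSequence T R g) (j : Fin (k + 1)) :
    g j ∈ LinearMap.ker (T ^ ((j : ℕ) + 1)) := by
  rw [LinearMap.mem_ker, pow_succ', mul_apply, hg.pow_apply hTR, ← mul_apply,
    (hTR.pow_right _).eq, mul_apply, hg.2.1, map_zero]

theorem injOn_ker_pow (hTR : Commute T R) (h : Disjoint (LinearMap.ker T) (LinearMap.ker R))
    (m : ℕ) : Set.InjOn R (LinearMap.ker (T ^ m)) := by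
  rw [← LinearMap.disjoint_ker_iff_injOn, Submodule.disjoint_def] at *
  induction m with
  | zero => simp
  | succ m ih =>
    intro x hx hRx
    rw [LinearMap.mem_ker] at hRx
    refine h x (ih (T x) ?_ ?_) hRx
    · rwa [LinearMap.mem_ker, ← mul_apply, ← pow_succ]
    · rw [LinearMap.mem_ker, ← mul_apply, ← hTR.eq, mul_apply, hRx, map_zero]

theorem mapsTo_ker_pow (hTR : Commute T R) (m : ℕ) :
    Set.MapsTo R (LinearMap.ker (T ^ m)) (LinearMap.ker (T ^ m)) := by
  intro x hx
  rw [SetLike.mem_coe, LinearMap.mem_ker] at *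
  rw [← mul_apply, (hTR.pow_left m).eq, mul_apply, hx, map_zero]

theorem IsJordanSequence.notMem_ker_pow (hTR : Commute T R)
    (h : Disjoint (LinearMap.ker T) (LinearMap.ker R)) {g : Fin (k + 1) → V}
    (hg : IsJordanSequence T R g) (j : Fin (k + 1)) : g j ∉ LinearMap.ker (T ^ (j : ℕ)) := by
  have hmaps := mapsTo_ker_pow hTR 1
  have hinj := (injOn_ker_pow hTR h 1).iterate hmaps j
  rw [pow_one] at hinj
  rw [LinearMap.mem_ker, hg.pow_apply hTR, Module.End.pow_apply]
  intro h0
  exact hg.1 (hinj hg.2.1 (Submodule.zero_mem _) (h0.trans (iterate_map_zero R j).symm))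

theorem exists_isJordanSequence (hTR : Commute T R) {x : V}
    (hx : x ∈ LinearMap.ker (T ^ (k + 1))) (hx' : x ∉ LinearMap.ker (T ^ k)) :
    ∃ g : Fin (k + 1) → V, IsJordanSequence T R g ∧ g (Fin.last k) = (R ^ k) x := by
  have hpow (i j : ℕ) : T ((R ^ j) ((T ^ i) x)) = (R ^ j) ((T ^ (i + 1)) x) := by
    rw [← mul_apply, (hTR.pow_right j).eq, mul_apply, pow_succ', mul_apply]
  refine ⟨fun j => (R ^ (j : ℕ)) ((T ^ (k - j : ℕ)) x), ⟨hx', (hpow _ _).trans hx, fun j => ?_⟩, ?_⟩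
  · have hsub : k - (j.castSucc : ℕ) = k - (j.succ : ℕ) + 1 := by
      simp only [Fin.val_castSucc, Fin.val_succ]; omega
    dsimp only
    rw [hpow, hsub, Fin.val_succ, pow_succ', mul_apply, Fin.val_castSucc]
  · simp

theorem exists_isJordanSequence_iff (hTR : Commute T R)
    (h : Disjoint (LinearMap.ker T) (LinearMap.ker R)) :
    (∃ g : Fin (k + 1) → V, IsJordanSequence T R g) ↔
      LinearMap.ker (T ^ k) < LinearMap.ker (T ^ (k + 1)) := by
  have hle : LinearMap.ker (T ^ k) ≤ LinearMap.ker (T ^ (k + 1)) := by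
    rw [pow_succ', mul_eq_comp]
    exact LinearMap.ker_le_ker_comp (T ^ k) T
  rw [lt_iff_le_not_ge, and_iff_right hle, SetLike.not_le_iff_exists]
  constructor
  · rintro ⟨g, hg⟩
    have hmem := hg.mem_ker_pow_succ hTR (Fin.last k)
    have hnot := hg.notMem_ker_pow hTR h (Fin.last k)
    rw [Fin.val_last] at hmem hnot
    exact ⟨_, hmem, hnot⟩
  · rintro ⟨x, hx, hx'⟩
    obtain ⟨g, hg, -⟩ := exists_isJordanSequence hTR hx hx'
    exact ⟨g, hg⟩

variable [FiniteDimensional K V]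

theorem surjOn_ker_pow (hTR : Commute T R) (h : Disjoint (LinearMap.ker T) (LinearMap.ker R))
    (m : ℕ) : Set.SurjOn R (LinearMap.ker (T ^ m)) (LinearMap.ker (T ^ m)) := by
  intro x hx
  have hinj : Function.Injective (R.restrict (mapsTo_ker_pow hTR m)) :=
    fun y z hyz => Subtype.ext (injOn_ker_pow hTR h m y.2 z.2 (congr_arg Subtype.val hyz))
  obtain ⟨y, hy⟩ := LinearMap.injective_iff_surjective.1 hinj ⟨x, hx⟩
  exact ⟨y, y.2, congr_arg Subtype.val hy⟩

theorem span_isJordanSequence (hTR : Commute T R)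
    (h : Disjoint (LinearMap.ker T) (LinearMap.ker R)) :
    Submodule.span K {x | ∃ (k : ℕ) (g : Fin (k + 1) → V), IsJordanSequence T R g ∧ ∃ j, x = g j} =
      ⨆ k : ℕ, LinearMap.ker (T ^ k) := by
  apply le_antisymm
  · rw [Submodule.span_le]
    rintro _ ⟨k, g, hg, j, rfl⟩
    exact Submodule.mem_iSup_of_mem _ (hg.mem_ker_pow_succ hTR j)
  refine iSup_le fun k => ?_
  induction k with
  | zero =>
    rw [pow_zero, one_eq_id, LinearMap.ker_id]
    exact bot_le
  | succ k ih =>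
    intro x hx
    by_cases hx' : x ∈ LinearMap.ker (T ^ k)
    · exact ih hx'
    -- `R` permutes `ker T ^ (k + 1)`, so `x` is the last vector `R ^ k y` of a chain.
    obtain ⟨y, hy, rfl⟩ := (surjOn_ker_pow hTR h (k + 1)).iterate k hx
    have hy' : y ∉ LinearMap.ker (T ^ k) := fun hy0 =>
      hx' ((mapsTo_ker_pow hTR k).iterate k hy0)
    obtain ⟨g, hg, hlast⟩ := exists_isJordanSequence hTR hy hy'
    exact Submodule.subset_span ⟨k, g, hg, Fin.last k, by rw [hlast, Module.End.pow_apply]⟩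

variable {f : End K V} {a : K}

theorem span_isJordanSequence_sub_smul (hfR : Commute f R)
    (h : Disjoint (f.eigenspace a) (LinearMap.ker R)) :
    Submodule.span K {x | ∃ (k : ℕ) (g : Fin (k + 1) → V),
      IsJordanSequence (f - a • 1) R g ∧ ∃ j, x = g j} = f.maxGenEigenspace a := by
  rw [span_isJordanSequence (hfR.sub_left ((Commute.one_left R).smul_left a))
    (by rwa [← genEigenspace_one])]
  simp only [← genEigenspace_nat, iSup_genEigenspace_eq]

theorem sSup_length_isJordanSequence_sub_smul (hfR : Commute f R)
    (h : Disjoint (f.eigenspace a) (LinearMap.ker R)) :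
    sSup {m | ∃ (k : ℕ) (g : Fin (k + 1) → V), IsJordanSequence (f - a • 1) R g ∧ m = k + 1} =
      (minpoly K f).rootMultiplicity a := by
  have hexists (k : ℕ) : (∃ g : Fin (k + 1) → V, IsJordanSequence (f - a • 1) R g) ↔
      f.genEigenspace a k < f.genEigenspace a (k + 1 : ℕ) := by
    rw [exists_isJordanSequence_iff (hfR.sub_left ((Commute.one_left R).smul_left a))
      (by rwa [← genEigenspace_one]), genEigenspace_nat, genEigenspace_nat]
  set r := (minpoly K f).rootMultiplicity a
  have hbound : r ∈ upperBounds {m | ∃ (k : ℕ) (g : Fin (k + 1) → V),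
      IsJordanSequence (f - a • 1) R g ∧ m = k + 1} := by
    rintro _ ⟨k, g, hg, rfl⟩
    by_contra! hlt
    refine ((hexists k).1 ⟨g, hg⟩).not_ge ((f.genEigenspace_le_maximal a _).trans ?_)
    rw [maxGenEigenspace_eq_genEigenspace_rootMultiplicity]
    exact (f.genEigenspace a).monotone (by exact_mod_cast Nat.le_of_lt_succ hlt)
  rcases hk : r with _ | k
  · exact Nat.le_zero.1 (csSup_le' (hk ▸ hbound))
  · obtain ⟨g, hg⟩ := (hexists k).2 (genEigenspace_lt_succ_of_rootMultiplicity_eq hk)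
    exact IsGreatest.csSup_eq ⟨⟨k, g, hg, rfl⟩, hk ▸ hbound⟩

end JordanSequences

end EigenvaluePlacement

namespace MatrixPencil

noncomputable section

open Module Matrix EigenvaluePlacement

section Chart

/-- The chart `z ↦ (γ - z)⁻¹`, `∞ ↦ 0` of the Riemann sphere away from `γ`. -/
def chart (γ : ℂ) : OnePoint ℂ → ℂ
  | ∞ => 0
  | (z : ℂ) => (γ - z)⁻¹

@[simp]
theorem chart_infty (γ : ℂ) : chart γ ∞ = 0 := rfl

@[simp]
theorem chart_coe (γ z : ℂ) : chart γ (z : OnePoint ℂ) = (γ - z)⁻¹ := rfl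

theorem sub_ne_zero_of_coe_ne {γ z : ℂ} (h : (z : OnePoint ℂ) ≠ γ) : γ - z ≠ 0 :=
  sub_ne_zero.2 fun hγ => h (congr_arg _ hγ.symm)

theorem chart_injOn (γ : ℂ) : Set.InjOn (chart γ) {(γ : OnePoint ℂ)}ᶜ := by
  intro lam h lam' h' heq
  induction lam using OnePoint.rec <;> induction lam' using OnePoint.rec
  · rfl
  · exact absurd heq.symm (inv_ne_zero (sub_ne_zero_of_coe_ne h'))
  · exact absurd heq (inv_ne_zero (sub_ne_zero_of_coe_ne h))
  · simpa using heq

theorem chart_surjOn (γ : ℂ) : Set.SurjOn (chart γ) {(γ : OnePoint ℂ)}ᶜ Set.univ := by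
  intro t _
  by_cases ht : t = 0
  · exact ⟨∞, OnePoint.infty_ne_coe γ, ht.symm⟩
  · refine ⟨((γ - t⁻¹ : ℂ) : OnePoint ℂ), ?_, by simp⟩
    rw [Set.mem_compl_singleton_iff, Ne, OnePoint.coe_eq_coe]
    simpa using ht

theorem conjPoint_involutive : Function.Involutive conjPoint := by
  intro lam
  induction lam using OnePoint.rec <;> simp [conjPoint]

theorem chart_conjPoint (γ : ℝ) (lam : OnePoint ℂ) :
    chart γ (conjPoint lam) = starRingEnd ℂ (chart γ lam) := by
  induction lam using OnePoint.rec <;> simp [conjPoint]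

end Chart

section Resolvent

variable {F ι : Type*} [Field F]

theorem smul_map_sub_map {K : Type*} [Field K] [Algebra F K] (E A : Matrix ι ι F) (γ : F) :
    algebraMap F K γ • E.map (algebraMap F K) - A.map (algebraMap F K) =
      (γ • E - A).map (algebraMap F K) := by
  ext i j
  simp only [Matrix.sub_apply, Matrix.smul_apply, map_apply, smul_eq_mul, map_sub, map_mul]

variable [Fintype ι] [DecidableEq ι] {E A : Matrix ι ι F} {γ : F}

/-- The resolvent `(γ E - A)⁻¹ E` of the matrix pencil `s E - A`; the matrix inverse is only
meaningful if `γ E - A` is invertible. -/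
def resolvent (E A : Matrix ι ι F) (γ : F) : Matrix ι ι F :=
  (γ • E - A)⁻¹ * E

theorem mul_resolvent (hB : IsUnit (γ • E - A)) : (γ • E - A) * resolvent E A γ = E := by
  rw [resolvent, ← mul_assoc, mul_nonsing_inv _ ((isUnit_iff_isUnit_det _).1 hB), one_mul]

theorem mul_smul_resolvent_sub_one (hB : IsUnit (γ • E - A)) :
    (γ • E - A) * (γ • resolvent E A γ - 1) = A := by
  rw [mul_sub, mul_smul_comm, mul_resolvent hB, mul_one, sub_sub_cancel]

theorem smul_mul_resolvent_sub_smul (hB : IsUnit (γ • E - A)) {z : F} (hz : γ - z ≠ 0) :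
    ((γ - z) • (γ • E - A)) * (resolvent E A γ - (γ - z)⁻¹ • 1) = A - z • E := by
  rw [smul_mul_assoc, mul_sub, mul_resolvent hB, smul_sub, mul_smul_comm, smul_smul,
    mul_inv_cancel₀ hz, one_smul, mul_one, sub_smul]
  abel

theorem isUnit_smul_map_sub_map_iff {K : Type*} [Field K] [Algebra F K] :
    IsUnit (algebraMap F K γ • E.map (algebraMap F K) - A.map (algebraMap F K)) ↔
      IsUnit (γ • E - A) := by
  rw [smul_map_sub_map, isUnit_iff_isUnit_det, isUnit_iff_isUnit_det, ← RingHom.mapMatrix_apply,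
    ← RingHom.map_det, isUnit_map_iff]

theorem resolvent_map {K : Type*} [Field K] [Algebra F K] (hB : IsUnit (γ • E - A)) :
    resolvent (E.map (algebraMap F K)) (A.map (algebraMap F K)) (algebraMap F K γ) =
      (resolvent E A γ).map (algebraMap F K) := by
  have hB' := isUnit_smul_map_sub_map_iff (K := K) |>.2 hB
  apply hB'.mul_left_cancel
  rw [mul_resolvent hB', smul_map_sub_map, ← Matrix.map_mul, mul_resolvent hB]

theorem resolvent_add_rankOne (hB : IsUnit (γ • E - A)) (u w : ι → F) :
    resolvent (E + vecMulVec ((γ • E - A) *ᵥ u) w) (A + γ • vecMulVec ((γ • E - A) *ᵥ u) w) γ =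
      resolvent E A γ + vecMulVec u w := by
  rw [resolvent, smul_add, add_sub_add_right_eq_sub, mul_add, mul_vecMulVec, mulVec_mulVec,
    nonsing_inv_mul _ ((isUnit_iff_isUnit_det _).1 hB), one_mulVec, ← resolvent]

theorem resolvent_smul {c : F} (hc : c ≠ 0) (hB : IsUnit (γ • E - A)) :
    resolvent (c • E) (c • A) γ = resolvent E A γ := by
  have hsmul : γ • c • E - c • A = c • (γ • E - A) := by rw [smul_sub, smul_comm]
  have hB' : IsUnit (γ • c • E - c • A) := by
    rw [hsmul]
    exact (isUnit_smul_iff (Units.mk0 c hc) _).2 hB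
  apply hB'.mul_left_cancel
  rw [mul_resolvent hB', hsmul, smul_mul_assoc, mul_resolvent hB]

end Resolvent

section Spectrum

variable {n : ℕ} {P : MatrixPencil n} {γ : ℂ} {lam : OnePoint ℂ}

/-- The operator `R` for which the Jordan chains at `lam` of the pencil with resolvent `f` at `γ`
are the Jordan sequences of `f - chart γ lam` and `R`. -/
def chartTwist {n : ℕ} (f : End ℂ (Fin n → ℂ)) (γ : ℂ) : OnePoint ℂ → End ℂ (Fin n → ℂ)
  | ∞ => γ • f - 1
  | (z : ℂ) => (γ - z)⁻¹ • f

@[simp]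
theorem chartTwist_infty {n : ℕ} (f : End ℂ (Fin n → ℂ)) (γ : ℂ) :
    chartTwist f γ ∞ = γ • f - 1 := rfl

@[simp]
theorem chartTwist_coe {n : ℕ} (f : End ℂ (Fin n → ℂ)) (γ z : ℂ) :
    chartTwist f γ (z : OnePoint ℂ) = (γ - z)⁻¹ • f := rfl

theorem commute_chartTwist (f : End ℂ (Fin n → ℂ)) (γ : ℂ) (lam : OnePoint ℂ) :
    Commute f (chartTwist f γ lam) := by
  induction lam using OnePoint.rec with
  | infty => exact ((Commute.refl f).smul_right γ).sub_right (Commute.one_right f)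
  | coe z => exact (Commute.refl f).smul_right _

theorem disjoint_eigenspace_ker_chartTwist (f : End ℂ (Fin n → ℂ)) (h : lam ≠ γ) :
    Disjoint (f.eigenspace (chart γ lam)) (LinearMap.ker (chartTwist f γ lam)) := by
  rw [Submodule.disjoint_def]
  intro x hx hker
  rw [End.mem_eigenspace_iff] at hx
  induction lam using OnePoint.rec with
  | infty => simpa [hx] using hker
  | coe z => simpa [hx, sub_ne_zero_of_coe_ne h] using hker

theorem isJordanChain_iff (hB : IsUnit (γ • P.E - P.A)) (h : lam ≠ γ) {k : ℕ}
    (g : Fin (k + 1) → Fin n → ℂ) :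
    P.IsJordanChain lam g ↔
      IsJordanSequence (toLin' (resolvent P.E P.A γ) - chart γ lam • 1)
        (chartTwist (toLin' (resolvent P.E P.A γ)) γ lam) g := by
  induction lam using OnePoint.rec with
  | infty =>
    rw [← isJordanSequence_comp_iff (S := toLin' (γ • P.E - P.A))
      (mulVec_injective_iff_isUnit.2 hB)]
    have hE : toLin' (γ • P.E - P.A) ∘ₗ (toLin' (resolvent P.E P.A γ) - chart γ ∞ • 1) =
        toLin' P.E := by
      rw [chart_infty, zero_smul, sub_zero, ← toLin'_mul, mul_resolvent hB]
    have hA : toLin' (γ • P.E - P.A) ∘ₗ chartTwist (toLin' (resolvent P.E P.A γ)) γ ∞ =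
        toLin' P.A := by
      rw [chartTwist_infty, End.one_eq_id, ← toLin'_one, ← map_smul, ← map_sub, ← toLin'_mul,
        mul_smul_resolvent_sub_one hB]
    rw [hE, hA]
    rfl
  | coe z =>
    have hz := sub_ne_zero_of_coe_ne h
    have hS : IsUnit ((γ - z) • (γ • P.E - P.A)) := (isUnit_smul_iff (Units.mk0 _ hz) _).2 hB
    rw [← isJordanSequence_comp_iff (S := toLin' ((γ - z) • (γ • P.E - P.A)))
      (mulVec_injective_iff_isUnit.2 hS)]
    have hA : toLin' ((γ - z) • (γ • P.E - P.A)) ∘ₗ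
        (toLin' (resolvent P.E P.A γ) - chart γ z • 1) = toLin' (P.A - z • P.E) := by
      rw [chart_coe, End.one_eq_id, ← toLin'_one, ← map_smul, ← map_sub, ← toLin'_mul,
        smul_mul_resolvent_sub_smul hB hz]
    have hE : toLin' ((γ - z) • (γ • P.E - P.A)) ∘ₗ
        chartTwist (toLin' (resolvent P.E P.A γ)) γ z = toLin' P.E := by
      rw [chartTwist_coe, ← map_smul, ← toLin'_mul, smul_mul_smul_comm, mul_inv_cancel₀ hz,
        one_smul, mul_resolvent hB]
    rw [hE, hA]
    rfl

theorem rootDim_eq (hB : IsUnit (γ • P.E - P.A)) (h : lam ≠ γ) :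
    P.rootDim lam = (resolvent P.E P.A γ).charpoly.rootMultiplicity (chart γ lam) := by
  have hspan : P.rootSubspace lam =
      End.maxGenEigenspace (toLin' (resolvent P.E P.A γ)) (chart γ lam) := by
    rw [rootSubspace]
    simp_rw [isJordanChain_iff hB h]
    exact span_isJordanSequence_sub_smul (commute_chartTwist _ γ lam)
      (disjoint_eigenspace_ker_chartTwist _ h)
  rw [rootDim, hspan, LinearMap.finrank_maxGenEigenspace_eq, charpoly_toLin']

theorem longestChain_eq (hB : IsUnit (γ • P.E - P.A)) (h : lam ≠ γ) :
    P.longestChain lam = (minpoly ℂ (resolvent P.E P.A γ)).rootMultiplicity (chart γ lam) := by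
  rw [longestChain]
  simp_rw [isJordanChain_iff hB h]
  rw [sSup_length_isJordanSequence_sub_smul (commute_chartTwist _ γ lam)
    (disjoint_eigenspace_ker_chartTwist _ h), minpoly_toLin']

theorem isJordanChain_singleton_iff (P : MatrixPencil n) (lam : OnePoint ℂ) (x : Fin n → ℂ) :
    P.IsJordanChain lam (k := 0) (fun _ => x) ↔
      x ≠ 0 ∧ x ∈ LinearMap.ker (toLin' (P.eval lam)) := by
  rw [LinearMap.mem_ker, toLin'_apply]
  induction lam using OnePoint.rec with
  | infty => simp [IsJordanChain, eval]
  | coe z => simp [IsJordanChain, eval, sub_mulVec, sub_eq_zero, eq_comm]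

theorem dimKer_eq (hB : IsUnit (γ • P.E - P.A)) (h : lam ≠ γ) :
    P.dimKer lam = finrank ℂ (End.eigenspace (toLin' (resolvent P.E P.A γ)) (chart γ lam)) := by
  have hchain (x : Fin n → ℂ) : (x ≠ 0 ∧ x ∈ LinearMap.ker (toLin' (P.eval lam))) ↔
      x ≠ 0 ∧ x ∈ End.eigenspace (toLin' (resolvent P.E P.A γ)) (chart γ lam) := by
    rw [← isJordanChain_singleton_iff, isJordanChain_iff hB h, End.eigenspace_def]
    simp [IsJordanSequence]
  have hker : LinearMap.ker (toLin' (P.eval lam)) =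
      End.eigenspace (toLin' (resolvent P.E P.A γ)) (chart γ lam) := by
    ext x
    by_cases hx : x = 0
    · simp [hx]
    · exact (and_congr_right_iff.1 (hchain x)) hx
  rw [dimKer, hker]

theorem mem_spec_iff_dimKer_pos (P : MatrixPencil n) (lam : OnePoint ℂ) :
    lam ∈ P.spec ↔ 0 < P.dimKer lam := by
  rw [dimKer, Nat.pos_iff_ne_zero, Ne, Submodule.finrank_eq_zero]
  induction lam using OnePoint.rec with
  | infty =>
    change ¬ IsUnit P.E ↔ ¬ LinearMap.ker (toLin' P.E) = ⊥
    rw [LinearMap.ker_eq_bot, ← mulVec_injective_iff_isUnit]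
    rfl
  | coe z =>
    change End.HasEigenvalue (toLin' (z • P.E - P.A)) 0 ↔
      ¬ LinearMap.ker (toLin' (z • P.E - P.A)) = ⊥
    rw [End.hasEigenvalue_iff, End.eigenspace_zero]

theorem mem_spec_iff (hB : IsUnit (γ • P.E - P.A)) (h : lam ≠ γ) :
    lam ∈ P.spec ↔ (minpoly ℂ (resolvent P.E P.A γ)).IsRoot (chart γ lam) := by
  rw [mem_spec_iff_dimKer_pos, dimKer_eq hB h, Nat.pos_iff_ne_zero, Ne,
    Submodule.finrank_eq_zero, ← Ne, ← End.hasEigenvalue_iff, End.hasEigenvalue_iff_isRoot,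
    minpoly_toLin']

theorem notMem_spec_of_isUnit (hB : IsUnit (γ • P.E - P.A)) : (γ : OnePoint ℂ) ∉ P.spec := by
  rw [mem_spec_iff_dimKer_pos, dimKer, not_lt, Nat.le_zero, Submodule.finrank_eq_zero,
    LinearMap.ker_eq_bot]
  exact mulVec_injective_iff_isUnit.2 hB

theorem sumLongestChains_eq (hB : IsUnit (γ • P.E - P.A)) :
    P.sumLongestChains = (minpoly ℂ (resolvent P.E P.A γ)).natDegree := by
  set q := minpoly ℂ (resolvent P.E P.A γ)
  have hq0 : q ≠ 0 := (minpoly_monic _).ne_zero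
  have hne : P.spec ⊆ {(γ : OnePoint ℂ)}ᶜ := by
    rintro _ h rfl
    exact notMem_spec_of_isUnit hB h
  have hbij : Set.BijOn (chart γ) P.spec (q.roots.toFinset : Set ℂ) := by
    refine ⟨fun lam h => ?_, (chart_injOn γ).mono hne, fun t ht => ?_⟩
    · rw [Finset.mem_coe, Multiset.mem_toFinset, mem_roots hq0]
      exact (mem_spec_iff hB (hne h)).1 h
    · rw [Finset.mem_coe, Multiset.mem_toFinset, mem_roots hq0] at ht
      obtain ⟨lam, hlam, rfl⟩ := chart_surjOn γ (Set.mem_univ t)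
      exact ⟨lam, (mem_spec_iff hB hlam).2 ht, rfl⟩
  rw [sumLongestChains, finsum_mem_eq_of_bijOn (chart γ) hbij
    (g := fun t => q.rootMultiplicity t) fun lam h => longestChain_eq hB (hne h),
    finsum_mem_coe_finset]
  simp_rw [← count_roots]
  rw [Multiset.toFinset_sum_count_eq]
  exact splits_iff_card_roots.1 (IsAlgClosed.splits q)

end Spectrum

section Regular

variable {n : ℕ} {P : MatrixPencil n} {lam : OnePoint ℂ}

theorem eval_det_poly (P : MatrixPencil n) (z : ℂ) :
    P.poly.det.eval z = (z • P.E - P.A).det := by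
  rw [← coe_evalRingHom, RingHom.map_det]
  congr 1
  ext i j
  simp only [poly, RingHom.mapMatrix_apply, map_apply, Matrix.sub_apply, Matrix.smul_apply,
    smul_eq_mul, coe_evalRingHom, eval_sub, eval_mul, eval_X, eval_C]

theorem isRegular_of_isUnit {γ : ℂ} (hB : IsUnit (γ • P.E - P.A)) : P.IsRegular := fun h =>
  ((isUnit_iff_isUnit_det _).1 hB).ne_zero (by rw [← eval_det_poly, h, eval_zero])

theorem IsRegular.exists_isUnit (hP : P.IsRegular) (𝕜 : Type*) [Field 𝕜] [Infinite 𝕜]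
    [Algebra 𝕜 ℂ] {κ : Type*} [Finite κ] (μ : κ → OnePoint ℂ) :
    ∃ γ : 𝕜, IsUnit (algebraMap 𝕜 ℂ γ • P.E - P.A) ∧ ∀ i, μ i ≠ algebraMap 𝕜 ℂ γ := by
  have hinj := (algebraMap 𝕜 ℂ).injective
  have hroots : {x : 𝕜 | P.poly.det.IsRoot (algebraMap 𝕜 ℂ x)}.Finite :=
    (finite_setOfPred_isRoot hP).preimage hinj.injOn
  have hrange : {x : 𝕜 | (algebraMap 𝕜 ℂ x : OnePoint ℂ) ∈ Set.range μ}.Finite :=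
    (Set.finite_range μ).preimage (OnePoint.coe_injective.comp hinj).injOn
  obtain ⟨γ, hγ⟩ := (hroots.union hrange).infinite_compl.nonempty
  rw [Set.mem_compl_iff, Set.mem_union, not_or] at hγ
  refine ⟨γ, ?_, fun i hi => hγ.2 ⟨i, hi⟩⟩
  rw [isUnit_iff_isUnit_det, ← eval_det_poly]
  exact Ne.isUnit hγ.1

theorem IsRegular.exists_isUnit_of_point (hP : P.IsRegular) (lam : OnePoint ℂ) :
    ∃ γ : ℂ, IsUnit (γ • P.E - P.A) ∧ lam ≠ γ := by
  obtain ⟨γ, hB, hγ⟩ := hP.exists_isUnit ℂ fun _ : Unit => lam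
  exact ⟨γ, hB, hγ ()⟩

theorem IsRegular.mem_spec_iff_rootDim_pos (hP : P.IsRegular) :
    lam ∈ P.spec ↔ 0 < P.rootDim lam := by
  obtain ⟨γ, hB, h⟩ := hP.exists_isUnit_of_point lam
  rw [rootDim_eq hB h, rootMultiplicity_pos (charpoly_monic _).ne_zero, mem_spec_iff hB h,
    ← minpoly_toLin', ← charpoly_toLin', ← End.hasEigenvalue_iff_isRoot,
    End.hasEigenvalue_iff_isRoot_charpoly]

theorem IsRegular.longestChain_le_rootDim (hP : P.IsRegular) (lam : OnePoint ℂ) :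
    P.longestChain lam ≤ P.rootDim lam := by
  obtain ⟨γ, hB, h⟩ := hP.exists_isUnit_of_point lam
  rw [longestChain_eq hB h, rootDim_eq hB h]
  exact rootMultiplicity_le_rootMultiplicity_of_dvd (charpoly_monic _).ne_zero
    (minpoly_dvd_charpoly _) _

theorem IsRegular.two_le_dimKer_iff (hP : P.IsRegular) :
    2 ≤ P.dimKer lam ↔ P.longestChain lam < P.rootDim lam := by
  obtain ⟨γ, hB, h⟩ := hP.exists_isUnit_of_point lam
  rw [dimKer_eq hB h, two_le_finrank_eigenspace_iff, longestChain_eq hB h, rootDim_eq hB h,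
    minpoly_toLin', charpoly_toLin']

theorem isPlacement_of_rootDim_add_longestChain {Q : MatrixPencil n} {l : ℕ}
    {μ : Fin l → OnePoint ℂ} {m : Fin l → ℕ} (hP : P.IsRegular) (hQ : Q.IsRegular)
    (hm : ∀ i, 0 < m i)
    (hμ : ∀ i, Q.rootDim (μ i) + P.longestChain (μ i) = m i + P.rootDim (μ i))
    (hrest : ∀ lam ∉ Set.range μ, Q.rootDim lam + P.longestChain lam = P.rootDim lam) :
    P.IsPlacement Q μ m := by
  have hle := hP.longestChain_le_rootDim
  have hspec {lam : OnePoint ℂ} : lam ∉ P.spec ↔ P.rootDim lam = 0 := by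
    rw [hP.mem_spec_iff_rootDim_pos, Nat.pos_iff_ne_zero, not_not]
  refine ⟨?_, fun i _ => ?_, fun lam _ hlam => ?_, fun i hi => ?_, fun lam hlam hlamμ => ?_⟩
  · ext lam
    rw [hQ.mem_spec_iff_rootDim_pos, Set.mem_union, Set.mem_ofPred_eq, hP.two_le_dimKer_iff,
      hP.mem_spec_iff_rootDim_pos]
    by_cases hlam : lam ∈ Set.range μ
    · obtain ⟨i, rfl⟩ := hlam
      have := hμ i
      have := hle (μ i)
      have := hm i
      simp only [Set.mem_range_self, true_or, iff_true]
      omega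
    · have := hrest lam hlam
      simp only [hlam, false_or]
      omega
  · have := hμ i
    omega
  · have := hrest lam hlam
    omega
  · have := hμ i
    have := hle (μ i)
    have := hspec.1 hi
    omega
  · have := hrest lam hlamμ
    have := hspec.1 hlam
    omega

end Regular

section TargetPoly

theorem rootMultiplicity_prod_X_sub_C_pow {R ι : Type*} [CommRing R] [IsDomain R]
    [DecidableEq R] (s : Finset ι) (a : ι → R) (m : ι → ℕ) (t : R) :
    (∏ i ∈ s, (X - C (a i)) ^ m i).rootMultiplicity t = ∑ i ∈ s, if a i = t then m i else 0 := by
  rw [← count_roots, roots_prod _ _ (Finset.prod_ne_zero_iff.2 fun i _ =>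
    pow_ne_zero _ (X_sub_C_ne_zero _)), Multiset.count_bind]
  refine Finset.sum_congr rfl fun i _ => ?_
  rw [roots_pow, roots_X_sub_C, Multiset.count_nsmul, Multiset.count_singleton]
  simp [eq_comm]

variable {n l : ℕ} {μ : Fin l → OnePoint ℂ} {m : Fin l → ℕ} {γ : ℂ}

/-- The monic polynomial with roots `chart γ (μ i)` of multiplicities `m i`, which replaces the
minimal polynomial of the resolvent when the eigenvalues `μ i` are placed. -/
def targetPoly (γ : ℂ) (μ : Fin l → OnePoint ℂ) (m : Fin l → ℕ) : ℂ[X] :=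
  ∏ i, (X - C (chart γ (μ i))) ^ m i

theorem targetPoly_monic (γ : ℂ) (μ : Fin l → OnePoint ℂ) (m : Fin l → ℕ) :
    (targetPoly γ μ m).Monic :=
  monic_prod_of_monic _ _ fun _ _ => (monic_X_sub_C _).pow _

theorem natDegree_targetPoly (γ : ℂ) (μ : Fin l → OnePoint ℂ) (m : Fin l → ℕ) :
    (targetPoly γ μ m).natDegree = ∑ i, m i := by
  rw [targetPoly, natDegree_prod_of_monic _ _ fun _ _ => (monic_X_sub_C _).pow _]
  simp [(monic_X_sub_C _).natDegree_pow]

theorem rootMultiplicity_targetPoly (hμ : Function.Injective μ) (hγ : ∀ i, μ i ≠ γ) (i : Fin l) :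
    (targetPoly γ μ m).rootMultiplicity (chart γ (μ i)) = m i := by
  classical
  rw [targetPoly, rootMultiplicity_prod_X_sub_C_pow]
  simp [(chart_injOn γ).eq_iff (hγ _) (hγ i), hμ.eq_iff]

theorem isRoot_targetPoly_iff (hm : ∀ i, 0 < m i) {t : ℂ} :
    (targetPoly γ μ m).IsRoot t ↔ ∃ i, chart γ (μ i) = t := by
  rw [targetPoly, isRoot_prod]
  simp_rw [Finset.mem_univ, true_and]
  refine exists_congr fun i => ?_
  rw [IsRoot.def, eval_pow, pow_eq_zero_iff (hm i).ne', eval_sub, eval_X, eval_C, sub_eq_zero,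
    eq_comm]

theorem rootMultiplicity_targetPoly_of_notMem (hm : ∀ i, 0 < m i) (hγ : ∀ i, μ i ≠ γ)
    {lam : OnePoint ℂ} (hlam : lam ≠ γ) (h : lam ∉ Set.range μ) :
    (targetPoly γ μ m).rootMultiplicity (chart γ lam) = 0 := by
  refine rootMultiplicity_eq_zero fun hroot => h ?_
  obtain ⟨i, hi⟩ := (isRoot_targetPoly_iff hm).1 hroot
  exact ⟨i, chart_injOn γ (hγ i) hlam hi⟩

theorem targetPoly_map_conj (γ : ℝ) (hμ : Function.Injective μ)
    (hconj : ∀ i, ∃ j, μ j = conjPoint (μ i))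
    (hmconj : ∀ i j, μ j = conjPoint (μ i) → m i = m j) :
    (targetPoly γ μ m).map (starRingEnd ℂ) = targetPoly γ μ m := by
  choose σ hσ using hconj
  have hσinj : Function.Injective σ := fun i j hij =>
    hμ (conjPoint_involutive.injective (by rw [← hσ, ← hσ, hij]))
  rw [targetPoly, Polynomial.map_prod]
  refine Fintype.prod_bijective σ (Finite.injective_iff_bijective.1 hσinj) _ _ fun i => ?_
  rw [Polynomial.map_pow, Polynomial.map_sub, map_X, map_C, hσ, chart_conjPoint,
    hmconj i _ (hσ i)]

variable {P Q : MatrixPencil n}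

theorem isPlacement_of_charpoly (hB : IsUnit (γ • P.E - P.A)) (hB' : IsUnit (γ • Q.E - Q.A))
    (hμ : Function.Injective μ) (hγ : ∀ i, μ i ≠ γ) (hm : ∀ i, 0 < m i)
    (h : (resolvent Q.E Q.A γ).charpoly * minpoly ℂ (resolvent P.E P.A γ) =
      targetPoly γ μ m * (resolvent P.E P.A γ).charpoly) :
    P.IsPlacement Q μ m := by
  have hP := isRegular_of_isUnit hB
  have hQ := isRegular_of_isUnit hB'
  have hmult {lam : OnePoint ℂ} (hlam : lam ≠ γ) : Q.rootDim lam + P.longestChain lam =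
      (targetPoly γ μ m).rootMultiplicity (chart γ lam) + P.rootDim lam := by
    rw [rootDim_eq hB hlam, rootDim_eq hB' hlam, longestChain_eq hB hlam,
      ← rootMultiplicity_mul ((charpoly_monic _).mul (minpoly_monic _)).ne_zero,
      ← rootMultiplicity_mul ((targetPoly_monic _ _ _).mul (charpoly_monic _)).ne_zero, h]
  refine isPlacement_of_rootDim_add_longestChain hP hQ hm (fun i => ?_) fun lam hlam => ?_
  · rw [hmult (hγ i), rootMultiplicity_targetPoly hμ hγ]
  by_cases hlamγ : lam = γ
  · have hPγ := hP.mem_spec_iff_rootDim_pos.not.1 (notMem_spec_of_isUnit hB)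
    have hQγ := hQ.mem_spec_iff_rootDim_pos.not.1 (notMem_spec_of_isUnit hB')
    have hle := hP.longestChain_le_rootDim γ
    rw [hlamγ]
    omega
  · rw [hmult hlamγ, rootMultiplicity_targetPoly_of_notMem hm hγ hlamγ hlam, zero_add]

theorem range_eq_spec_of_targetPoly_eq_minpoly (hB : IsUnit (γ • P.E - P.A))
    (hγ : ∀ i, μ i ≠ γ) (hm : ∀ i, 0 < m i)
    (h : targetPoly γ μ m = minpoly ℂ (resolvent P.E P.A γ)) : Set.range μ = P.spec := by
  ext lam
  by_cases hlam : lam = γ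
  · subst hlam
    exact iff_of_false (fun ⟨i, hi⟩ => hγ i hi) (notMem_spec_of_isUnit hB)
  · rw [mem_spec_iff hB hlam, ← h, isRoot_targetPoly_iff hm]
    exact exists_congr fun i => ((chart_injOn γ).eq_iff (hγ i) hlam).symm

theorem infty_mem_spec_of_E_eq_zero [NeZero n] (hE : P.E = 0) : ∞ ∈ P.spec := by
  change ¬ IsUnit P.E
  rw [hE]
  exact not_isUnit_zero

end TargetPoly

section SmallFactor

theorem exists_dvd_natDegree_le {F : Type*} [Field F] {q : F[X]} {d : ℕ}
    (hd : ∀ f : F[X], Irreducible f → f.natDegree ≤ d) (hq : ¬ IsUnit q) (hq0 : q ≠ 0) :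
    ∃ f, f ∣ q ∧ ¬ IsUnit f ∧ f.natDegree ≤ d := by
  obtain ⟨f, hf, hdvd⟩ := WfDvdMonoid.exists_irreducible_factor hq hq0
  exact ⟨f, hdvd, hf.not_isUnit, hd f hf⟩

theorem exists_map_ofReal_eq {p : ℂ[X]} (hp : p.map (starRingEnd ℂ) = p) :
    ∃ p₀ : ℝ[X], p₀.map (algebraMap ℝ ℂ) = p := by
  have hlifts : p ∈ lifts (algebraMap ℝ ℂ) := by
    rw [lifts_iff_coeff_lifts]
    intro k
    have hk := congr(($hp).coeff k)
    rw [coeff_map] at hk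
    obtain ⟨r, hr⟩ := Complex.conj_eq_iff_real.1 hk
    exact ⟨r, hr.symm⟩
  exact (mem_lifts _).1 hlifts

theorem exists_isRoot_of_conjPoint_eq {l : ℕ} {μ : Fin l → OnePoint ℂ} {m : Fin l → ℕ} {γ : ℝ}
    {p : ℝ[X]} (hm : ∀ i, 0 < m i) (hp : p.map (algebraMap ℝ ℂ) = targetPoly γ μ m)
    (hpu : ¬ IsUnit p) (hμ : ∀ i, conjPoint (μ i) = μ i) : ∃ t, p.IsRoot t := by
  have hdeg : (p.map (algebraMap ℝ ℂ)).degree ≠ 0 := by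
    rw [degree_map]
    exact fun h => hpu (isUnit_iff_degree_eq_zero.2 h)
  obtain ⟨z, hz⟩ := IsAlgClosed.exists_root _ hdeg
  obtain ⟨i, rfl⟩ := (isRoot_targetPoly_iff hm).1 (hp ▸ hz)
  obtain ⟨t, ht⟩ := Complex.conj_eq_iff_real.1
    ((chart_conjPoint γ (μ i)).symm.trans (by rw [hμ i]))
  rw [ht] at hz
  exact ⟨t, hz.of_map (algebraMap ℝ ℂ).injective⟩

end SmallFactor

section ExtendScalars

variable {n : ℕ} {𝕜 : Type*} [Field 𝕜] [Algebra 𝕜 ℂ]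

/-- The pencil `s E - A` with coefficient matrices over a subfield `𝕜` of `ℂ`; the cases `𝕜 = ℝ`
and `𝕜 = ℂ` are the real and the complex version of the theorem. -/
def extendScalars (E A : Matrix (Fin n) (Fin n) 𝕜) : MatrixPencil n :=
  ⟨E.map (algebraMap 𝕜 ℂ), A.map (algebraMap 𝕜 ℂ)⟩

theorem extendScalars_add (E A E' A' : Matrix (Fin n) (Fin n) 𝕜) :
    extendScalars E A + extendScalars E' A' = extendScalars (E + E') (A + A') := by
  refine MatrixPencil.ext ?_ ?_ <;>
    exact (Matrix.map_add _ (map_add _) _ _).symm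

theorem rank_extendScalars_smul_vecMulVec {α β : 𝕜} {u w : Fin n → 𝕜} (hα : α ≠ 0)
    (hu : u ≠ 0) (hw : w ≠ 0) :
    (extendScalars (α • vecMulVec u w) (β • vecMulVec u w)).rank = 1 := by
  set φ : 𝕜 →+* ℂ := algebraMap 𝕜 ℂ
  have hpoly : (extendScalars (α • vecMulVec u w) (β • vecMulVec u w)).poly =
      vecMulVec (fun i => (C (φ α) * X - C (φ β)) * C (φ (u i))) (fun j => C (φ (w j))) := by
    ext i j : 1
    simp only [poly, extendScalars, Matrix.sub_apply, Matrix.smul_apply, map_apply,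
      vecMulVec_apply, smul_eq_mul, map_mul, φ]
    ring
  have hlin : C (φ α) * X - C (φ β) ≠ 0 := by
    intro h
    have hcoeff := congr(($h).coeff 1)
    simp only [coeff_sub, coeff_C_mul, coeff_X_one, coeff_C_succ, mul_one, sub_zero,
      coeff_zero, map_eq_zero] at hcoeff
    exact hα hcoeff
  obtain ⟨i, hi⟩ := Function.ne_iff.1 hu
  obtain ⟨j, hj⟩ := Function.ne_iff.1 hw
  refine IsGreatest.csSup_eq ⟨⟨fun _ => i, fun _ => j, ?_⟩, ?_⟩
  · rw [hpoly, det_fin_one, submatrix_apply, vecMulVec_apply]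
    exact mul_ne_zero (mul_ne_zero hlin (C_ne_zero.2 ((map_ne_zero φ).2 hi)))
      (C_ne_zero.2 ((map_ne_zero φ).2 hj))
  · rintro r ⟨f, g, hdet⟩
    by_contra! hr
    have : Nontrivial (Fin r) := Fin.nontrivial_iff_two_le.2 hr
    apply hdet
    have hsub (a b : Fin n → ℂ[X]) :
        (vecMulVec a b).submatrix f g = vecMulVec (a ∘ f) (b ∘ g) := rfl
    rw [hpoly, hsub, det_vecMulVec]

variable {E A E' A' : Matrix (Fin n) (Fin n) 𝕜} {γ : 𝕜} {l : ℕ} {μ : Fin l → OnePoint ℂ}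
  {m : Fin l → ℕ} {p : 𝕜[X]}

theorem minpoly_resolvent_map (hB : IsUnit (γ • E - A)) :
    minpoly ℂ (resolvent (E.map (algebraMap 𝕜 ℂ)) (A.map (algebraMap 𝕜 ℂ)) (algebraMap 𝕜 ℂ γ)) =
      (minpoly 𝕜 (resolvent E A γ)).map (algebraMap 𝕜 ℂ) := by
  rw [resolvent_map hB, minpoly_map_algebraMap]

theorem natDegree_minpoly_resolvent (hB : IsUnit (γ • E - A)) :
    (minpoly 𝕜 (resolvent E A γ)).natDegree = (extendScalars E A).sumLongestChains := by
  have hBℂ := isUnit_smul_map_sub_map_iff (K := ℂ) |>.2 hB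
  rw [sumLongestChains_eq (P := extendScalars E A) hBℂ, extendScalars, minpoly_resolvent_map hB,
    natDegree_map]

theorem isPlacement_extendScalars_of_charpoly (hB : IsUnit (γ • E - A))
    (hB' : IsUnit (γ • E' - A')) (hμ : Function.Injective μ) (hγ : ∀ i, μ i ≠ algebraMap 𝕜 ℂ γ)
    (hm : ∀ i, 0 < m i) (hp : p.map (algebraMap 𝕜 ℂ) = targetPoly (algebraMap 𝕜 ℂ γ) μ m)
    (h : (resolvent E' A' γ).charpoly * minpoly 𝕜 (resolvent E A γ) =
      p * (resolvent E A γ).charpoly) :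
    (extendScalars E' A').IsRegular ∧
      (extendScalars E A).IsPlacement (extendScalars E' A') μ m := by
  have hBℂ := isUnit_smul_map_sub_map_iff (K := ℂ) |>.2 hB
  have hBℂ' := isUnit_smul_map_sub_map_iff (K := ℂ) |>.2 hB'
  refine ⟨isRegular_of_isUnit (P := extendScalars E' A') hBℂ',
    isPlacement_of_charpoly (P := extendScalars E A) (Q := extendScalars E' A')
      hBℂ hBℂ' hμ hγ hm ?_⟩
  rw [extendScalars, extendScalars, resolvent_map hB, resolvent_map hB', minpoly_map_algebraMap,
    charpoly_map, charpoly_map, ← hp, ← Polynomial.map_mul, h, Polynomial.map_mul]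

/-- The conclusion of the theorem for the pencil `s E - A` over `𝕜`, with the perturbation
`(α s - β) u w^T`. -/
def IsRankOnePlacement (E A : Matrix (Fin n) (Fin n) 𝕜) (μ : Fin l → OnePoint ℂ) (m : Fin l → ℕ)
    (α β : 𝕜) (u w : Fin n → 𝕜) : Prop :=
  (extendScalars E A + extendScalars (α • vecMulVec u w) (β • vecMulVec u w)).IsRegular ∧
    (extendScalars E A).IsPlacement
      (extendScalars E A + extendScalars (α • vecMulVec u w) (β • vecMulVec u w)) μ m

theorem isRankOnePlacement_of_charpoly (hB : IsUnit (γ • E - A)) (hμ : Function.Injective μ)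
    (hγ : ∀ i, μ i ≠ algebraMap 𝕜 ℂ γ) (hm : ∀ i, 0 < m i)
    (hp : p.map (algebraMap 𝕜 ℂ) = targetPoly (algebraMap 𝕜 ℂ γ) μ m) {u w : Fin n → 𝕜}
    (h : (resolvent E A γ + vecMulVec u w).charpoly * minpoly 𝕜 (resolvent E A γ) =
      p * (resolvent E A γ).charpoly) :
    IsRankOnePlacement E A μ m 1 γ ((γ • E - A) *ᵥ u) w := by
  have hB' : IsUnit (γ • (E + vecMulVec ((γ • E - A) *ᵥ u) w) -
      (A + γ • vecMulVec ((γ • E - A) *ᵥ u) w)) := by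
    rwa [smul_add, add_sub_add_right_eq_sub]
  rw [IsRankOnePlacement, extendScalars_add, one_smul]
  exact isPlacement_extendScalars_of_charpoly hB hB' hμ hγ hm hp
    (by rw [resolvent_add_rankOne hB, h])

-- Adding a pencil of size one to itself rescales it, which leaves all Jordan chains in place.
theorem isRankOnePlacement_self {E A : Matrix (Fin 1) (Fin 1) 𝕜} (hB : IsUnit (γ • E - A))
    (hμ : Function.Injective μ) (hγ : ∀ i, μ i ≠ algebraMap 𝕜 ℂ γ) (hm : ∀ i, 0 < m i)
    (h : (minpoly 𝕜 (resolvent E A γ)).map (algebraMap 𝕜 ℂ) =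
      targetPoly (algebraMap 𝕜 ℂ γ) μ m) :
    IsRankOnePlacement E A μ m (E 0 0) (A 0 0) 1 1 := by
  have : CharZero 𝕜 := (algebraMap 𝕜 ℂ).charZero
  have hself (M : Matrix (Fin 1) (Fin 1) 𝕜) : M + M 0 0 • vecMulVec 1 1 = (2 : 𝕜) • M := by
    ext i j
    rw [Subsingleton.elim i 0, Subsingleton.elim j 0]
    simp [two_mul]
  have hB' : IsUnit (γ • (2 : 𝕜) • E - (2 : 𝕜) • A) := by
    rw [smul_comm, ← smul_sub]
    exact (isUnit_smul_iff (Units.mk0 (2 : 𝕜) two_ne_zero) _).2 hB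
  rw [IsRankOnePlacement, extendScalars_add, hself, hself]
  exact isPlacement_extendScalars_of_charpoly hB hB' hμ hγ hm h
    (by rw [resolvent_smul two_ne_zero hB, mul_comm])

theorem exists_isRankOnePlacement (hB : IsUnit (γ • E - A)) (hμ : Function.Injective μ)
    (hγ : ∀ i, μ i ≠ algebraMap 𝕜 ℂ γ) (hm : ∀ i, 0 < m i)
    (hp : p.map (algebraMap 𝕜 ℂ) = targetPoly (algebraMap 𝕜 ℂ γ) μ m)
    (hsum : ∑ i, m i = (extendScalars E A).sumLongestChains) :
    ∃ (α β : 𝕜) (u w : Fin n → 𝕜), α ≠ 0 ∧ IsRankOnePlacement E A μ m α β u w ∧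
      ((p = minpoly 𝕜 (resolvent E A γ) →
        n = 1 ∧ E ≠ 0 ∨ ∃ f, f ∣ p ∧ ¬ IsUnit f ∧ f.natDegree < n) →
        (extendScalars (α • vecMulVec u w) (β • vecMulVec u w)).rank = 1) := by
  set N := resolvent E A γ
  by_cases hself : p = minpoly 𝕜 N ∧ n = 1 ∧ E ≠ 0
  · obtain ⟨rfl, rfl, hE⟩ := hself
    have hE0 : E 0 0 ≠ 0 := fun h => hE (by
      ext i j
      rw [Subsingleton.elim i 0, Subsingleton.elim j 0, h, Matrix.zero_apply])
    exact ⟨_, _, 1, 1, hE0, isRankOnePlacement_self hB hμ hγ hm hp,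
      fun _ => rank_extendScalars_smul_vecMulVec hE0 one_ne_zero one_ne_zero⟩
  have hpm : p.Monic := monic_of_injective (algebraMap 𝕜 ℂ).injective (hp ▸ targetPoly_monic _ _ _)
  have hdeg : p.natDegree = (minpoly 𝕜 N).natDegree := by
    rw [natDegree_minpoly_resolvent hB, ← hsum, ← natDegree_targetPoly (algebraMap 𝕜 ℂ γ) μ, ← hp,
      natDegree_map]
  by_cases hfactor : p = minpoly 𝕜 N → ∃ f, f ∣ minpoly 𝕜 N ∧ ¬ IsUnit f ∧ f.natDegree < n
  · obtain ⟨u, w, h, hu, hw⟩ := exists_charpoly_add_vecMulVec_mul_minpoly_and_ne_zero N hpm hdeg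
      (by simpa using hfactor)
    refine ⟨1, γ, _, w, one_ne_zero, isRankOnePlacement_of_charpoly hB hμ hγ hm hp h, fun _ =>
      rank_extendScalars_smul_vecMulVec one_ne_zero (fun h0 => hu ?_) hw⟩
    exact mulVec_injective_iff_isUnit.2 hB (h0.trans (mulVec_zero _).symm)
  · obtain ⟨u, w, h⟩ := exists_charpoly_add_vecMulVec_mul_minpoly N hpm hdeg
    push Not at hfactor
    obtain ⟨hpmin, hnot⟩ := hfactor
    refine ⟨1, γ, _, w, one_ne_zero, isRankOnePlacement_of_charpoly hB hμ hγ hm hp h, fun hC => ?_⟩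
    obtain hn | ⟨f, hf, hfu, hfdeg⟩ := hC hpmin
    · exact absurd ⟨hpmin, hn⟩ hself
    · exact absurd hfdeg (hnot f (hpmin ▸ hf) hfu).not_gt

theorem range_eq_spec_extendScalars (hB : IsUnit (γ • E - A))
    (hγ : ∀ i, μ i ≠ algebraMap 𝕜 ℂ γ) (hm : ∀ i, 0 < m i)
    (hp : p.map (algebraMap 𝕜 ℂ) = targetPoly (algebraMap 𝕜 ℂ γ) μ m)
    (hpmin : p = minpoly 𝕜 (resolvent E A γ)) : Set.range μ = (extendScalars E A).spec := by
  have hBℂ := isUnit_smul_map_sub_map_iff (K := ℂ) |>.2 hB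
  refine range_eq_spec_of_targetPoly_eq_minpoly (P := extendScalars E A) hBℂ hγ hm ?_
  rw [extendScalars, minpoly_resolvent_map hB, ← hpmin, hp]

theorem ne_zero_of_forall_ne_infty [NeZero n]
    (hspec : Set.range μ = (extendScalars E A).spec)
    (hinfty : ∀ i, μ i ∈ (extendScalars E A).spec → μ i ≠ ∞) : E ≠ 0 := by
  intro hE
  have hmem : ∞ ∈ (extendScalars E A).spec :=
    infty_mem_spec_of_E_eq_zero (by rw [extendScalars, hE, Matrix.map_zero _ (map_zero _)])
  obtain ⟨i, hi⟩ := hspec ▸ hmem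
  exact hinfty i (hi ▸ hmem) hi

end ExtendScalars

section Placement

variable {n l : ℕ} {μ : Fin l → OnePoint ℂ} {m : Fin l → ℕ}

theorem extendScalars_complex (P : MatrixPencil n) : extendScalars P.E P.A = P := rfl

theorem extendScalars_complex_rankOne (α β : ℂ) (u w : Fin n → ℂ) :
    extendScalars (α • vecMulVec u w) (β • vecMulVec u w) = rankOnePencil α β u (star w) := by
  rw [rankOnePencil, star_star]
  rfl

theorem extendScalars_real_rankOne (α β : ℝ) (u w : Fin n → ℝ) :
    extendScalars (α • vecMulVec u w) (β • vecMulVec u w) =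
      rankOnePencil α β (fun i => (u i : ℂ)) (fun i => (w i : ℂ)) := by
  ext i j <;> simp [extendScalars, rankOnePencil, vecMulVec_apply]

theorem exists_complex_placement (P : MatrixPencil n) (hP : P.IsRegular) (hμ : Function.Injective μ)
    (hm : ∀ i, 0 < m i) (hsum : ∑ i, m i = P.sumLongestChains) :
    ∃ (α β : ℂ) (u v : Fin n → ℂ), α ≠ 0 ∧
      (P + rankOnePencil α β u v).IsRegular ∧
      P.IsPlacement (P + rankOnePencil α β u v) μ m ∧
      (n ≠ 0 → (n = 1 → ∀ i, μ i ∈ P.spec → μ i ≠ ∞) →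
        (rankOnePencil α β u v).rank = 1) := by
  obtain ⟨γ, hB, hγ⟩ := hP.exists_isUnit ℂ μ
  obtain ⟨α, β, u, w, hα, ⟨hreg, hpl⟩, hrank⟩ := exists_isRankOnePlacement (𝕜 := ℂ) hB hμ hγ hm
    (map_id (p := targetPoly γ μ m)) hsum
  rw [extendScalars_complex, extendScalars_complex_rankOne] at hreg hpl
  rw [extendScalars_complex_rankOne] at hrank
  refine ⟨α, β, u, star w, hα, hreg, hpl, fun hn hinfty => hrank fun hmin => ?_⟩
  have : NeZero n := ⟨hn⟩
  obtain hn1 | hn2 : n = 1 ∨ 1 < n := by omega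
  · exact .inl ⟨hn1, ne_zero_of_forall_ne_infty
      (range_eq_spec_extendScalars (𝕜 := ℂ) hB hγ hm map_id hmin) (hinfty hn1)⟩
  · obtain ⟨f, hf, hfu, hf1⟩ := exists_dvd_natDegree_le (d := 1)
      (fun f hf => (natDegree_eq_of_degree_eq_some
        (IsAlgClosed.degree_eq_one_of_irreducible ℂ hf)).le)
      (hmin ▸ minpoly.not_isUnit ℂ _) (targetPoly_monic γ μ m).ne_zero
    exact .inr ⟨f, hf, hfu, hf1.trans_lt hn2⟩

theorem exists_real_placement (P : MatrixPencil n) (hP : P.IsRegular) (hμ : Function.Injective μ)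
    (hm : ∀ i, 0 < m i) (hsum : ∑ i, m i = P.sumLongestChains) (hreal : P.IsReal)
    (hconj : ∀ i, ∃ j, μ j = conjPoint (μ i))
    (hmconj : ∀ i j, μ j = conjPoint (μ i) → m i = m j) :
    ∃ (α β : ℝ) (u v : Fin n → ℝ), α ≠ 0 ∧
      (P + rankOnePencil α β (fun i => (u i : ℂ)) (fun i => (v i : ℂ))).IsRegular ∧
      P.IsPlacement (P + rankOnePencil α β (fun i => (u i : ℂ)) (fun i => (v i : ℂ))) μ m ∧
      (n ≠ 0 → (n = 1 → ∀ i, μ i ∈ P.spec → μ i ≠ ∞) →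
        (n = 2 → ∀ i, μ i ∈ P.spec → conjPoint (μ i) = μ i) →
        (rankOnePencil (n := n) α β (fun i => (u i : ℂ)) (fun i => (v i : ℂ))).rank = 1) := by
  obtain ⟨E, A, hE, hA⟩ := hreal
  obtain rfl : P = extendScalars E A := MatrixPencil.ext hE hA
  obtain ⟨γ, hBℂ, hγ⟩ := hP.exists_isUnit ℝ μ
  have hB := isUnit_smul_map_sub_map_iff.1 hBℂ
  obtain ⟨p, hp⟩ := exists_map_ofReal_eq (targetPoly_map_conj γ hμ hconj hmconj)
  obtain ⟨α, β, u, w, hα, ⟨hreg, hpl⟩, hrank⟩ := exists_isRankOnePlacement hB hμ hγ hm hp hsum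
  rw [extendScalars_real_rankOne] at hreg hpl hrank
  refine ⟨α, β, u, w, hα, hreg, hpl, fun hn hinfty hreal => hrank fun hmin => ?_⟩
  have : NeZero n := ⟨hn⟩
  have hspec := range_eq_spec_extendScalars hB hγ hm hp hmin
  have hpu : ¬ IsUnit p := hmin ▸ minpoly.not_isUnit ℝ _
  obtain hn1 | hn2 | hn3 : n = 1 ∨ n = 2 ∨ 2 < n := by omega
  · exact .inl ⟨hn1, ne_zero_of_forall_ne_infty hspec (hinfty hn1)⟩
  · obtain ⟨t, ht⟩ := exists_isRoot_of_conjPoint_eq hm hp hpu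
      fun i => hreal hn2 i (hspec ▸ Set.mem_range_self i)
    refine .inr ⟨X - C t, dvd_iff_isRoot.2 ht, not_isUnit_X_sub_C t, ?_⟩
    rw [natDegree_X_sub_C, hn2]
    exact one_lt_two
  · obtain ⟨f, hf, hfu, hf2⟩ := exists_dvd_natDegree_le (d := 2)
      (fun f hf => natDegree_le_of_degree_le hf.degree_le_two) hpu
      (hmin ▸ (minpoly_monic _).ne_zero)
    exact .inr ⟨f, hf, hfu, hf2.trans_lt hn3⟩

end Placement

end

end MatrixPencil

open MatrixPencil in
theorem theorem5p1 {n : ℕ} (P : MatrixPencil n) (hP : P.IsRegular)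
    {l : ℕ} (μ : Fin l → OnePoint ℂ) (hμ : Function.Injective μ)
    (m : Fin l → ℕ) (hm : ∀ i, 0 < m i) (hsum : ∑ i, m i = P.sumLongestChains) :
    (∃ (α β : ℂ) (u v : Fin n → ℂ), α ≠ 0 ∧
      (P + rankOnePencil α β u v).IsRegular ∧
      P.IsPlacement (P + rankOnePencil α β u v) μ m ∧
      (n ≠ 0 → (n = 1 → ∀ i, μ i ∈ P.spec → μ i ≠ ∞) →
        (rankOnePencil α β u v).rank = 1)) ∧
    (P.IsReal → (∀ i, ∃ j, μ j = conjPoint (μ i)) →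
      (∀ i j, μ j = conjPoint (μ i) → m i = m j) →
      ∃ (α β : ℝ) (u v : Fin n → ℝ), α ≠ 0 ∧
        (P + rankOnePencil α β (fun i => (u i : ℂ)) (fun i => (v i : ℂ))).IsRegular ∧
        P.IsPlacement (P + rankOnePencil α β (fun i => (u i : ℂ)) (fun i => (v i : ℂ))) μ m ∧
        (n ≠ 0 → (n = 1 → ∀ i, μ i ∈ P.spec → μ i ≠ ∞) →
          (n = 2 → ∀ i, μ i ∈ P.spec → conjPoint (μ i) = μ i) →
          (rankOnePencil (n := n) α β (fun i => (u i : ℂ)) (fun i => (v i : ℂ))).rank = 1)) :=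
  ⟨exists_complex_placement P hP hμ hm hsum, exists_real_placement P hP hμ hm hsum⟩
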